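/- **Setting.** Let $\kappa>0$ and $\lambda\in\mathbb C$. For a finite interval $\Lambda=[a,b]\subset\mathbb Z$ let $\mathcal H_\Lambda=\bigotimes_{x\in\Lambda}\mathbb C^2$, where $\mathbb C^2$ has the orthonormal basis $|0\rangle$ (vacant), $|1\rangle$ (occupied); let $\sigma_x^+$ (with $|0\rangle\mapsto|1\rangle$, $|1\rangle\mapsto 0$) and $\sigma_x^-=(\sigma_x^+)^*$ be the raising and lowering operators at $x$, $n_x=\sigma_x^+\sigma_x^-$, and $$H_{[c,d]}=\sum_{x=c}^{d-2}n_xn_{x+2}+\kappa\sum_{x=c}^{d-3}q_x^*q_x,\qquad q_x=\sigma^-_{x+1}\sigma^-_{x+2}-\lambda\,\sigma^-_x\sigma^-_{x+3}.$$ For an interval $\Lambda'\subseteq\Lambda$ let $G_{\Lambda'}$ be the orthogonal projection in $\mathcal H_\Lambda$ onto $\ker(H_{\Lambda'})\otimes\mathcal H_{\Lambda\setminus\Lambda'}$. A monomer-dimer tiling of $[1,3L]$ is a tiling by consecutive monomers (length $3$) and dimers (length $6$). Let $$\varphi_L=\sum_{(D_1,\dots,D_N)}\sigma^+_{D_1}\cdots\sigma^+_{D_N}|\mathbf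 0\rangle\in\mathcal H_{[1,3L]},\qquad \varphi_0=1,$$ where $|\mathbf 0\rangle$ is the all-vacant vector, the sum runs over all monomer-dimer tilings of $[1,3L]$, and $\sigma_D^+=\sigma_x^+$ if $D$ is a monomer starting at $x$, $\sigma_D^+=\lambda\,\sigma_{x+1}^+\sigma_{x+2}^+$ if $D$ is a dimer starting at $x$. For $k\ge1$ the ratio $\alpha_k=\|\varphi_{k-1}\|^2/\|\varphi_k\|^2$ depends on $\lambda$ only through $r=|\lambda|^2$, and for $n\ge4$ and $r\ge0$ we set $$f_n(r)=r\,\alpha_n\alpha_{n-2}\left(\frac{[1-\alpha_{n-1}(1+r)]^2}{1+2r}+\alpha_{n-3}\,\frac{r(1-\alpha_{n-1})^2}{1+r}\right),\qquad f(r)=\sup_{n\ge4}f_n(r)<\infty .$$ **Lemma (Norm bound).** Let $\Lambda$ be an interval of length $|\Lambda|\ge11$, let $\Lambda_1$ be its first $|\Lambda|-3$ sites and $\Lambda_2$ its last nine sites. Then for every $\lambda\neq0$ and every $\kappa>0$, $$\|G_{\Lambda_2}(1-G_\Lambda)G_{\Lambda_1}\|^2\le f(|\lambda|^2).$$ Moreover,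 $f(|\lambda|^2)<1/3$ for all $\lambda\in\mathbb C$ with $|\lambda|<5.3$. -/

import Mathlib

namespace FQH

noncomputable section

/-! ### The spin chain on a finite set of sites -/

/-- Particle configurations `{0,1}^Λ` (`1` = occupied = spin up, `0` = vacant = spin down). -/
abbrev Config (Λ : Finset ℤ) : Type := Λ → Fin 2

/-- The Hilbert space `⨂_{x ∈ Λ} ℂ²`, written in its orthonormal basis `|σ⟩`, `σ ∈ {0,1}^Λ`. -/
abbrev Hilb (Λ : Finset ℤ) : Type := EuclideanSpace ℂ (Config Λ)

/-- The operators on the Hilbert space of `Λ`. -/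
abbrev Op (Λ : Finset ℤ) : Type := Hilb Λ →L[ℂ] Hilb Λ

/-- The operator acting as the `2 × 2` matrix `A` (in the basis `|0⟩, |1⟩`) on the tensor factor
of the site `x` and as the identity on all other factors. It is only used for `x ∈ Λ`
(and is set to `0` otherwise). -/
def siteOp (Λ : Finset ℤ) (x : ℤ) (A : Matrix (Fin 2) (Fin 2) ℂ) : Op Λ :=
  if h : x ∈ Λ then
    Matrix.toEuclideanCLM (n := Config Λ) (𝕜 := ℂ)
      (Matrix.of fun s t =>
        if ∀ y : Λ, (y : ℤ) ≠ x → s y = t y then A (s ⟨x, h⟩) (t ⟨x, h⟩) else 0)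
  else 0

/-- The raising operator `σ⁺ₓ`, which maps `|0⟩` to `|1⟩` and `|1⟩` to `0` at the site `x`. -/
def raise (Λ : Finset ℤ) (x : ℤ) : Op Λ := siteOp Λ x !![0, 0; 1, 0]

/-- The lowering operator `σ⁻ₓ`, which maps `|1⟩` to `|0⟩` and `|0⟩` to `0` at the site `x`. -/
def lower (Λ : Finset ℤ) (x : ℤ) : Op Λ := siteOp Λ x !![0, 1; 0, 0]

/-- The occupation number `nₓ = (σ³ₓ + 1) / 2`. -/
def num (Λ : Finset ℤ) (x : ℤ) : Op Λ := siteOp Λ x !![0, 0; 0, 1]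

/-- `qₓ = σ⁻ₓ₊₁ σ⁻ₓ₊₂ - lam σ⁻ₓ σ⁻ₓ₊₃`. -/
def hop (Λ : Finset ℤ) (lam : ℂ) (x : ℤ) : Op Λ :=
  lower Λ (x + 1) * lower Λ (x + 2) - lam • (lower Λ x * lower Λ (x + 3))

/-- The Hamiltonian of the interval `[c, d]` with open boundary conditions, as an operator on the
Hilbert space of a set `Λ` of sites containing `[c, d]` (tensored with the identity on the
remaining sites). -/
def ham (Λ : Finset ℤ) (κ : ℝ) (lam : ℂ) (c d : ℤ) : Op Λ :=
  ∑ x ∈ Finset.Icc c (d - 2), num Λ x * num Λ (x + 2) +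
    (κ : ℂ) • ∑ x ∈ Finset.Icc c (d - 3), star (hop Λ lam x) * hop Λ lam x

/-- The orthogonal projection, in the Hilbert space of `Λ`, onto the ground-state space
`ker H_{[c, d]} ⊗ 𝓗_{Λ \ [c, d]}`. -/
def gsProj (Λ : Finset ℤ) (κ : ℝ) (lam : ℂ) (c d : ℤ) : Op Λ :=
  (LinearMap.ker (ham Λ κ lam c d : Hilb Λ →ₗ[ℂ] Hilb Λ)).starProjection

/-! ### Monomer-dimer tilings and the squeezed Tao-Thouless states -/

/-- The two basic dominoes that carry particles: monomers and dimers. -/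
inductive Domino : Type
  | monomer : Domino
  | dimer : Domino
  deriving DecidableEq

/-- The number of sites covered by a domino. -/
def Domino.length : Domino → ℕ
  | .monomer => 3
  | .dimer => 6

/-- The operator `σ⁺_D` attached to a domino `D` starting at the site `x`. -/
def Domino.create (Λ : Finset ℤ) (lam : ℂ) (x : ℤ) : Domino → Op Λ
  | .monomer => raise Λ x
  | .dimer => lam • (raise Λ (x + 1) * raise Λ (x + 2))

/-- The monomer-dimer tilings of an interval of `3 L` sites, as the ordered lists of their
dominoes; see `mem_tilings`. -/
def tilings : ℕ → Finset (List Domino)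
  | 0 => {[]}
  | 1 => {[Domino.monomer]}
  | L + 2 => (tilings (L + 1)).image (List.cons Domino.monomer) ∪
      (tilings L).image (List.cons Domino.dimer)

theorem mem_tilings (L : ℕ) (D : List Domino) :
    D ∈ tilings L ↔ (D.map Domino.length).sum = 3 * L := by
  induction L using Nat.strong_induction_on generalizing D with
  | _ L ih =>
    match L, ih with
    | 0, _ =>
      cases D with
      | nil => simp [tilings]
      | cons T D => cases T <;> simp [tilings, Domino.length]
    | 1, _ =>
      cases D with
      | nil => simp [tilings]
      | cons T D =>
        cases T
        · cases D with
          | nil => simp [tilings, Domino.length]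
          | cons T D => cases T <;> simp [tilings, Domino.length]
        · simp only [tilings, Domino.length, List.map_cons, List.sum_cons]
          simp
          omega
    | L + 2, ih =>
      cases D with
      | nil => simp [tilings]
      | cons T D =>
        cases T
        · simp [tilings, Domino.length, ih (L + 1) (by omega)]
          omega
        · simp [tilings, Domino.length, ih L (by omega)]
          omega

/-- The vector `|𝟎⟩` of all spins down. -/
def vacuum (Λ : Finset ℤ) : Hilb Λ := EuclideanSpace.single (fun _ => 0) 1

/-- The vector `σ⁺_{D₁} ⋯ σ⁺_{D_N} |𝟎⟩` for dominoes `D₁, …, D_N` laid consecutively from the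
site `x` on. -/
def tilingVec (Λ : Finset ℤ) (lam : ℂ) : ℤ → List Domino → Hilb Λ
  | _, [] => vacuum Λ
  | x, T :: D => T.create Λ lam x (tilingVec Λ lam (x + T.length) D)

/-- The squeezed Tao-Thouless state `φ_L` on `[1, 3 L]`: the sum over all monomer-dimer tilings. -/
def phi (lam : ℂ) (L : ℕ) : Hilb (Finset.Icc 1 (3 * (L : ℤ))) :=
  ∑ D ∈ tilings L, tilingVec _ lam 1 D

/-! ### The bounding function -/

/-- `α_k = ‖φ_{k-1}‖² / ‖φ_k‖²` for `k ≥ 1`, as a function of `r = |lam|²` (evaluated at the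
coupling `lam = √r`). -/
def alpha (r : ℝ) (k : ℕ) : ℝ :=
  ‖phi (Real.sqrt r : ℂ) (k - 1)‖ ^ 2 / ‖phi (Real.sqrt r : ℂ) k‖ ^ 2

/-- The functions `f_n`, `n ≥ 4`. -/
def fn (n : ℕ) (r : ℝ) : ℝ :=
  r * alpha r n * alpha r (n - 2) *
    ((1 - alpha r (n - 1) * (1 + r)) ^ 2 / (1 + 2 * r) +
      alpha r (n - 3) * (r * (1 - alpha r (n - 1)) ^ 2 / (1 + r)))

/-- `f = sup_{n ≥ 4} f_n`. -/
def fsup (r : ℝ) : ℝ := ⨆ n : {n : ℕ // 4 ≤ n}, fn n r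

end

end FQH

/-! Put r = |lam|², and let Z_n (`tilingWeight`) be the partition function of monomer-dimer tilings
of n cells with dimer activity r. Distinct tilings give distinct basis vectors, so ‖φ_n‖² = Z_n
(`norm_phi_sq`). With Z_{n+2} = Z_{n+1} + r Z_n this collapses f_{n+4} to r⁴ Z_n Z_{n+1} /
((1+r)(1+2r) Z_{n+2} Z_{n+3}). Maximizing over the ratio Z_{n+1}/Z_n gives a bound without n, which
is below 1/3 in the stated range.

For the norm bound it suffices to estimate ⟨g, f⟩ for g in the kernel of the last nine sites and f
in the kernel of the left part but orthogonal to the full kernel (`norm_proj_mul_sq_le`). The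
Hamiltonian is a sum of positive terms, so each kernel is cut out by local equations for amplitudes
(`Ground`): exclusion of 1?1, and f(…0110…) = lam f(…1001…). These confine the product of g and f to
the `Allowed` configurations.

In such a configuration, read dominoes leftwards from a frame p in {b, b+1, b+2}. Configurations
that differ only in the tiling of the n cells read form a sector. A hop on [a, b] either exchanges a
dimer for two monomers inside the tiling or acts beyond it (`HopPair.active`), so sector averages of
f yield elements of the full kernel. Orthogonality then forces each average to vanish
(`sectorMean_eq_zero`), and f vanishes where no frame reads two cells (`eq_zero_of_inactive`).

In a sector f has just two free constants, according to the rightmost domino, and the vanishing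
average ties them together. The nine-site equations make g depend on the two rightmost dominoes in a
known way. Cauchy-Schwarz now gives the constant f_n for n ≥ 4 and the value 0 for n = 2, 3
(`sector_bound`). Sectors are disjoint, so the estimates add up (`norm_sum_sq_le_of_ground`). -/

namespace FQH

/-! ### Partition functions and the bounding function -/

/-- The number of elementary cells (of three sites) covered by a list of dominoes. -/
def cells : List Domino → ℕ
  | [] => 0
  | .monomer :: D => cells D + 1
  | .dimer :: D => cells D + 2

/-- The number of dimers in a list of dominoes. -/
def dimers : List Domino → ℕ
  | [] => 0
  | .monomer :: D => dimers D
  | .dimer :: D => dimers D + 1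

theorem mem_tilings_iff_cells (n : ℕ) (D : List Domino) : D ∈ tilings n ↔ cells D = n := by
  have h : (D.map Domino.length).sum = 3 * cells D := by
    induction D with
    | nil => rfl
    | cons T D ih => cases T <;> simp [Domino.length, cells, ih] <;> ring
  rw [mem_tilings, h]
  omega

theorem sum_tilings_succ_succ {M : Type*} [AddCommMonoid M] (f : List Domino → M) (n : ℕ) :
    ∑ D ∈ tilings (n + 2), f D = ∑ D ∈ tilings (n + 1), f (.monomer :: D) +
      ∑ D ∈ tilings n, f (.dimer :: D) := by
  rw [tilings, Finset.sum_union, Finset.sum_image, Finset.sum_image]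
  · intro x _ y _ h; simpa using h
  · intro x _ y _ h; simpa using h
  · rw [Finset.disjoint_left]
    intro x hx hy
    simp only [Finset.mem_image] at hx hy
    obtain ⟨u, _, rfl⟩ := hx
    obtain ⟨v, _, hv⟩ := hy
    simp at hv

/-- The partition function of the monomer-dimer tilings of `n` cells with dimer activity `r`. -/
noncomputable def tilingWeight (r : ℝ) (n : ℕ) : ℝ := ∑ D ∈ tilings n, r ^ dimers D

@[simp] theorem tilingWeight_zero (r : ℝ) : tilingWeight r 0 = 1 := by
  simp [tilingWeight, tilings, dimers]

@[simp] theorem tilingWeight_one (r : ℝ) : tilingWeight r 1 = 1 := by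
  simp [tilingWeight, tilings, dimers]

theorem tilingWeight_succ_succ (r : ℝ) (n : ℕ) :
    tilingWeight r (n + 2) = tilingWeight r (n + 1) + r * tilingWeight r n := by
  simp only [tilingWeight, sum_tilings_succ_succ, dimers, pow_succ, Finset.mul_sum]
  congr 1
  exact Finset.sum_congr rfl fun _ _ => mul_comm _ _

theorem tilingWeight_pos {r : ℝ} (hr : 0 ≤ r) : ∀ n, 0 < tilingWeight r n
  | 0 => by simp
  | 1 => by simp
  | n + 2 => by
    rw [tilingWeight_succ_succ]
    have := tilingWeight_pos hr (n + 1)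
    have := tilingWeight_pos hr n
    positivity

/-- The closed form of `fn` in terms of two consecutive partition functions. -/
theorem fn_eq_of_alpha {r : ℝ} (hr : 0 ≤ r)
    (hα : ∀ k, alpha r (k + 1) = tilingWeight r k / tilingWeight r (k + 1)) (n : ℕ) :
    fn (n + 4) r = r ^ 4 * tilingWeight r n * tilingWeight r (n + 1) /
      ((1 + r) * (1 + 2 * r) * tilingWeight r (n + 2) * tilingWeight r (n + 3)) := by
  have e2 := tilingWeight_succ_succ r n
  have e3 := tilingWeight_succ_succ r (n + 1)
  have e4 := tilingWeight_succ_succ r (n + 2)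
  have p0 := tilingWeight_pos hr n
  have p1 := tilingWeight_pos hr (n + 1)
  have p2 := tilingWeight_pos hr (n + 2)
  have p3 := tilingWeight_pos hr (n + 3)
  have p4 := tilingWeight_pos hr (n + 4)
  rw [fn, show n + 4 - 2 = (n + 1) + 1 by omega, show n + 4 - 1 = (n + 2) + 1 by omega,
    show n + 4 - 3 = n + 1 by omega, hα (n + 3), hα (n + 1), hα (n + 2), hα n]
  simp only [add_assoc, Nat.reduceAdd] at *
  rw [e4, e3, e2]
  rw [e3, e2] at p3
  rw [e2] at p2
  rw [e4, e3, e2] at p4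
  generalize tilingWeight r (n + 1) = y at *
  generalize tilingWeight r n = z at *
  field_simp
  ring

/-- With s = √(1+r), y = Z_{n+1} and z = Z_n, the defect (s-1)² Z_{n+2} Z_{n+3} - r³ y z is the
perfect square (s-1)² (s y - r z)². The bound is thus the maximum over all ratios y/z, with no need
for the actual ratios. -/
theorem fn_le {r : ℝ} (hr : 0 ≤ r)
    (hα : ∀ k, alpha r (k + 1) = tilingWeight r k / tilingWeight r (k + 1)) (n : ℕ) :
    fn (n + 4) r ≤ r * (√(1 + r) - 1) ^ 2 / ((1 + r) * (1 + 2 * r)) := by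
  rw [fn_eq_of_alpha hr hα, tilingWeight_succ_succ r (n + 1), tilingWeight_succ_succ r n]
  have p0 := tilingWeight_pos hr n
  have p1 := tilingWeight_pos hr (n + 1)
  generalize tilingWeight r (n + 1) = y at *
  generalize tilingWeight r n = z at *
  obtain ⟨s, hs, rfl⟩ : ∃ s : ℝ, 1 ≤ s ∧ r = s ^ 2 - 1 :=
    ⟨√(1 + r), by rw [Real.one_le_sqrt]; linarith, by rw [Real.sq_sqrt] <;> linarith⟩
  rw [show 1 + (s ^ 2 - 1) = s ^ 2 by ring, Real.sqrt_sq (by linarith)]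
  have h1 : 0 < s ^ 2 * (1 + 2 * (s ^ 2 - 1)) := by
    have : 0 < s ^ 2 := by positivity
    have : 0 < 1 + 2 * (s ^ 2 - 1) := by linarith
    positivity
  have h2 : 0 < y + (s ^ 2 - 1) * z := by positivity
  have h3 : 0 < y + (s ^ 2 - 1) * z + (s ^ 2 - 1) * y := by positivity
  have key : (s ^ 2 - 1) ^ 3 * z * y ≤
      (s - 1) ^ 2 * ((y + (s ^ 2 - 1) * z) * (y + (s ^ 2 - 1) * z + (s ^ 2 - 1) * y)) := by
    have e : (s - 1) ^ 2 * ((y + (s ^ 2 - 1) * z) * (y + (s ^ 2 - 1) * z + (s ^ 2 - 1) * y)) -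
        (s ^ 2 - 1) ^ 3 * z * y = (s - 1) ^ 2 * (s * y - (s ^ 2 - 1) * z) ^ 2 := by ring
    have : 0 ≤ (s - 1) ^ 2 * (s * y - (s ^ 2 - 1) * z) ^ 2 := by positivity
    linarith
  rw [div_le_div_iff₀ (by rw [mul_assoc (_ * _)]; positivity) h1]
  have h4 : 0 ≤ (s ^ 2 - 1) * (s ^ 2 * (1 + 2 * (s ^ 2 - 1))) := mul_nonneg hr h1.le
  nlinarith [mul_le_mul_of_nonneg_left key h4]

theorem sqrt_bound_lt {r : ℝ} (hr : 0 ≤ r) (h : r < 5.3 ^ 2) :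
    r * (√(1 + r) - 1) ^ 2 / ((1 + r) * (1 + 2 * r)) < 1 / 3 := by
  obtain ⟨s, hs, rfl⟩ : ∃ s : ℝ, 1 ≤ s ∧ r = s ^ 2 - 1 :=
    ⟨√(1 + r), by rw [Real.one_le_sqrt]; linarith, by rw [Real.sq_sqrt] <;> linarith⟩
  rw [show 1 + (s ^ 2 - 1) = s ^ 2 by ring, Real.sqrt_sq (by linarith)]
  -- Here 1 + 5.3² = 29.09 < 5.4². Cleared of denominators, the goal is s⁴ - 6s³ + s² + 6s - 3 < 0
  -- on 1 ≤ s < 5.4.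
  have hs2 : s < 5.4 := by
    by_contra hc
    push Not at hc
    norm_num at h hc
    nlinarith
  have h1 : 0 < s ^ 2 * (1 + 2 * (s ^ 2 - 1)) := by
    have : 0 < s ^ 2 := by positivity
    have : 0 < 1 + 2 * (s ^ 2 - 1) := by linarith
    positivity
  rw [div_lt_div_iff₀ h1 (by norm_num)]
  norm_num at hs2
  have h5 : (s - 5.4) * s ^ 3 ≤ 0 := mul_nonpos_of_nonpos_of_nonneg (by norm_num; linarith) (by positivity)
  norm_num at h5
  have h6 : 0 ≤ (s - 1) * s ^ 2 := mul_nonneg (by linarith) (by positivity)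
  have h7 : 0 ≤ (s - 1) * s := mul_nonneg (by linarith) (by positivity)
  nlinarith [sq_nonneg (s - 1), mul_nonneg h7 (sub_nonneg.2 hs)]


/-! ### Amplitudes as functions of occupation numbers on ℤ -/

/-- The configuration on `Λ` described by an occupation function on `ℤ`. -/
def res (Λ : Finset ℤ) (s : ℤ → Bool) : Config Λ := fun y => if s y then 1 else 0

/-- The occupation function of a configuration, extended by vacant sites. -/
def ext (Λ : Finset ℤ) (σ : Config Λ) : ℤ → Bool := fun y =>
  if h : y ∈ Λ then decide (σ ⟨y, h⟩ = 1) else false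

theorem res_ext (Λ : Finset ℤ) (σ : Config Λ) : res Λ (ext Λ σ) = σ := by
  funext y
  obtain ⟨y, hy⟩ := y
  simp only [res, ext, hy, dif_pos, decide_eq_true_eq]
  generalize σ ⟨y, hy⟩ = u
  fin_cases u <;> simp

theorem ext_res (Λ : Finset ℤ) (s : ℤ → Bool) (hs : ∀ y, s y = true → y ∈ Λ) :
    ext Λ (res Λ s) = s := by
  funext y
  by_cases hy : y ∈ Λ
  · cases h : s y <;> simp [res, ext, hy, h]
  · cases h : s y
    · simp [ext, hy]
    · exact absurd (hs y h) hy

theorem res_update {Λ : Finset ℤ} (s : ℤ → Bool) {x : ℤ} (hx : x ∈ Λ) (u : Bool) :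
    Function.update (res Λ s) ⟨x, hx⟩ (if u then 1 else 0) = res Λ (Function.update s x u) := by
  funext y
  by_cases h : y = ⟨x, hx⟩
  · subst h; simp [res]
  · have : (y : ℤ) ≠ x := fun e => h (Subtype.ext e)
    simp [res, h, this]

theorem siteOp_apply {Λ : Finset ℤ} {x : ℤ} (hx : x ∈ Λ) (A : Matrix (Fin 2) (Fin 2) ℂ)
    (v : Hilb Λ) (σ : Config Λ) :
    siteOp Λ x A v σ = ∑ u, A (σ ⟨x, hx⟩) u * v (Function.update σ ⟨x, hx⟩ u) := by
  rw [siteOp, dif_pos hx, Matrix.ofLp_toEuclideanCLM, Matrix.mulVec, dotProduct]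
  symm
  apply Finset.sum_of_injOn (fun u => Function.update σ ⟨x, hx⟩ u)
  · intro u _ w _ h
    simpa using congrFun h ⟨x, hx⟩
  · intro u _; simp
  · intro t _ ht
    simp only [Matrix.of_apply]
    rw [if_neg, zero_mul]
    intro h
    apply ht
    refine ⟨t ⟨x, hx⟩, by simp, ?_⟩
    funext y
    by_cases hy : y = ⟨x, hx⟩
    · subst hy; simp
    · have : (y : ℤ) ≠ x := fun e => hy (Subtype.ext e)
      simp [hy, h y this]
  · intro u _
    simp only [Matrix.of_apply]
    rw [if_pos]
    · simp
    · intro y hy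
      have : y ≠ ⟨x, hx⟩ := fun e => hy (by rw [e])
      simp [this]

theorem raise_apply {Λ : Finset ℤ} {x : ℤ} (hx : x ∈ Λ) (v : Hilb Λ) (s : ℤ → Bool) :
    raise Λ x v (res Λ s) =
      if s x then v (res Λ (Function.update s x false)) else 0 := by
  rw [raise, siteOp_apply hx, Fin.sum_univ_two, ← res_update s hx false]
  cases h : s x <;> simp [res, h]

theorem lower_apply {Λ : Finset ℤ} {x : ℤ} (hx : x ∈ Λ) (v : Hilb Λ) (s : ℤ → Bool) :
    lower Λ x v (res Λ s) =
      if s x then 0 else v (res Λ (Function.update s x true)) := by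
  rw [lower, siteOp_apply hx, Fin.sum_univ_two, ← res_update s hx true]
  cases h : s x <;> simp [res, h]

theorem num_apply {Λ : Finset ℤ} {x : ℤ} (hx : x ∈ Λ) (v : Hilb Λ) (s : ℤ → Bool) :
    num Λ x v (res Λ s) = if s x then v (res Λ s) else 0 := by
  rw [num, siteOp_apply hx, Fin.sum_univ_two]
  cases h : s x
  · simp [res, h]
  · have h1 : Function.update (res Λ s) ⟨x, hx⟩ 1 = res Λ s := by
      rw [Function.update_eq_self_iff]; simp [res, h]
    rw [h1]
    simp [res, h]

/-! ### The norm of the squeezed Tao-Thouless states -/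

/-- The occupation function of dominoes laid consecutively from the site `x` on. -/
def layRight : ℤ → List Domino → ℤ → Bool
  | _, [], _ => false
  | x, .monomer :: D, y => decide (y = x) || layRight (x + 3) D y
  | x, .dimer :: D, y => decide (y = x + 1) || (decide (y = x + 2) || layRight (x + 6) D y)

theorem layRight_bounds : ∀ (D : List Domino) (x y : ℤ), layRight x D y = true →
    x ≤ y ∧ y < x + 3 * cells D
  | [], x, y, h => by simp [layRight] at h
  | .monomer :: D, x, y, h => by
    simp only [layRight, Bool.or_eq_true, decide_eq_true_eq] at h
    simp only [cells]
    rcases h with h | h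
    · omega
    · have := layRight_bounds D _ _ h; omega
  | .dimer :: D, x, y, h => by
    simp only [layRight, Bool.or_eq_true, decide_eq_true_eq] at h
    simp only [cells]
    rcases h with h | h | h
    · omega
    · omega
    · have := layRight_bounds D _ _ h; omega

theorem layRight_eq_false {D : List Domino} {x y : ℤ} (h : y < x) : layRight x D y = false := by
  by_contra hc
  have := layRight_bounds D x y (by simpa using hc)
  omega

/-- The first domino is visible at its first site, which a monomer occupies and a dimer leaves
vacant. -/
theorem layRight_injective : ∀ (D E : List Domino) (x : ℤ), layRight x D = layRight x E → D = E
  | [], [], _, _ => rfl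
  | [], .monomer :: E, x, h => by simpa [layRight] using congrFun h x
  | [], .dimer :: E, x, h => by simpa [layRight] using congrFun h (x + 1)
  | .monomer :: D, [], x, h => by simpa [layRight] using congrFun h x
  | .dimer :: D, [], x, h => by simpa [layRight] using congrFun h (x + 1)
  | .monomer :: D, .dimer :: E, x, h => by
    have := congrFun h x
    simp [layRight] at this
    rw [layRight_eq_false (by omega)] at this
    simp at this
  | .dimer :: D, .monomer :: E, x, h => by
    have := congrFun h x
    simp [layRight] at this
    rw [layRight_eq_false (by omega)] at this
    simp at this
  | .monomer :: D, .monomer :: E, x, h => by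
    rw [layRight_injective D E (x + 3)]
    funext y
    by_cases hy : y < x + 3
    · rw [layRight_eq_false hy, layRight_eq_false hy]
    · have := congrFun h y
      simpa [layRight, show y ≠ x by omega] using this
  | .dimer :: D, .dimer :: E, x, h => by
    rw [layRight_injective D E (x + 6)]
    funext y
    by_cases hy : y < x + 6
    · rw [layRight_eq_false hy, layRight_eq_false hy]
    · have := congrFun h y
      simpa [layRight, show y ≠ x + 1 by omega, show y ≠ x + 2 by omega] using this

theorem raise_single {Λ : Finset ℤ} {x : ℤ} (hx : x ∈ Λ) (s : ℤ → Bool) (h : s x = false) :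
    raise Λ x (EuclideanSpace.single (res Λ s) 1) =
      EuclideanSpace.single (res Λ (Function.update s x true)) 1 := by
  ext σ
  rw [← res_ext Λ σ, raise_apply hx]
  generalize ext Λ σ = t
  simp only [PiLp.single_apply]
  rw [← ite_and]
  congr 1
  rw [eq_iff_iff]
  constructor
  · rintro ⟨h1, h2⟩
    rw [← res_update s hx, ← h2, res_update, Function.update_idem, ← h1, Function.update_eq_self]
  · intro h1
    have h2 := congrFun h1 ⟨x, hx⟩
    have h3 : t x = true := by
      cases h4 : t x <;> simp [res, h4] at h2 ⊢
    refine ⟨h3, ?_⟩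
    rw [← res_update t hx, h1, res_update, Function.update_idem, ← h, Function.update_eq_self]

theorem tilingVec_eq (Λ : Finset ℤ) (lam : ℂ) : ∀ (D : List Domino) (x : ℤ),
    (∀ y, x ≤ y → y < x + 3 * cells D → y ∈ Λ) →
    tilingVec Λ lam x D = lam ^ dimers D • EuclideanSpace.single (res Λ (layRight x D)) 1
  | [], x, _ => by
    simp only [tilingVec, vacuum, dimers, pow_zero, one_smul]
    congr 1
  | .monomer :: D, x, h => by
    simp only [cells] at h
    have e := tilingVec_eq Λ lam D (x + 3) fun y h1 h2 => h y (by omega) (by push_cast; omega)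
    simp only [tilingVec, Domino.length, Domino.create, dimers]
    push_cast
    rw [e, map_smul, raise_single (h x le_rfl (by push_cast; omega)) _ (layRight_eq_false (by omega))]
    congr 3
    funext y
    by_cases hy : y = x <;> simp [layRight, hy]
  | .dimer :: D, x, h => by
    simp only [cells] at h
    have e := tilingVec_eq Λ lam D (x + 6) fun y h1 h2 => h y (by omega) (by push_cast; omega)
    simp only [tilingVec, Domino.length, Domino.create, dimers, Nat.cast_ofNat]
    rw [e, map_smul, smul_apply, mul_apply_eq_comp,
      raise_single (h (x + 2) (by omega) (by push_cast; omega)) _ (layRight_eq_false (by omega)),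
      raise_single (h (x + 1) (by omega) (by push_cast; omega)), smul_smul, pow_succ]
    · congr 3
      funext y
      by_cases hy : y = x + 1
      · simp [layRight, hy]
      · by_cases hy2 : y = x + 2 <;> simp [layRight, hy, hy2]
    · simp [layRight_eq_false]

/-- The tiling vectors are multiples of distinct, hence orthonormal, basis vectors, so only the
diagonal terms |lam|^(2·dimers) survive. -/
theorem norm_phi_sq (lam : ℂ) (L : ℕ) : ‖phi lam L‖ ^ 2 = tilingWeight (‖lam‖ ^ 2) L := by
  classical
  set Λ := Finset.Icc 1 (3 * (L : ℤ)) with hΛ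
  have hmem : ∀ D ∈ tilings L, ∀ y, (1 : ℤ) ≤ y → y < 1 + 3 * cells D → y ∈ Λ := by
    intro D hD y h1 h2
    rw [mem_tilings_iff_cells] at hD
    rw [hΛ, Finset.mem_Icc]
    omega
  have e : phi lam L = ∑ D ∈ tilings L,
      lam ^ dimers D • EuclideanSpace.single (res Λ (layRight 1 D)) (1 : ℂ) :=
    Finset.sum_congr rfl fun D hD => tilingVec_eq Λ lam D 1 (hmem D hD)
  have inj : ∀ D ∈ tilings L, ∀ E ∈ tilings L,
      res Λ (layRight 1 D) = res Λ (layRight 1 E) → D = E := by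
    intro D hD E hE h
    apply layRight_injective D E 1
    rw [← ext_res Λ (layRight 1 D), h, ext_res]
    · intro y hy
      obtain ⟨h1, h2⟩ := layRight_bounds E 1 y hy
      exact hmem E hE y h1 h2
    · intro y hy
      obtain ⟨h1, h2⟩ := layRight_bounds D 1 y hy
      exact hmem D hD y h1 h2
  have key : inner ℂ (phi lam L) (phi lam L) = ((tilingWeight (‖lam‖ ^ 2) L : ℝ) : ℂ) := by
    rw [e, sum_inner, tilingWeight]
    push_cast
    refine Finset.sum_congr rfl fun D hD => ?_
    rw [inner_sum, Finset.sum_eq_single D]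
    · rw [inner_smul_left, inner_smul_right, EuclideanSpace.inner_single_left]
      simp only [map_one, PiLp.single_apply, if_true, mul_one]
      rw [Complex.conj_mul']
      simp [← pow_mul, mul_comm]
    · intro E hE hne
      rw [inner_smul_left, inner_smul_right, EuclideanSpace.inner_single_left]
      rw [PiLp.single_apply, if_neg]
      · simp
      · intro h
        exact hne (inj D hD E hE h).symm
    · exact fun h => absurd hD h
  rw [inner_self_eq_norm_sq_to_K] at key
  apply Complex.ofReal_injective
  rw [← key, Complex.ofReal_pow]
  rfl

theorem alpha_succ {r : ℝ} (hr : 0 ≤ r) (k : ℕ) :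
    alpha r (k + 1) = tilingWeight r k / tilingWeight r (k + 1) := by
  have : ‖((√r : ℝ) : ℂ)‖ ^ 2 = r := by
    rw [Complex.norm_real, Real.norm_eq_abs, sq_abs, Real.sq_sqrt hr]
  rw [alpha, norm_phi_sq, norm_phi_sq, this, Nat.add_sub_cancel]


/-! ### Local equations for the ground states -/

/-- `s` and `t` agree except on `x, …, x + 3`, where they read `0110` and `1001`. -/
structure HopPair (x : ℤ) (s t : ℤ → Bool) : Prop where
  s0 : s x = false
  s1 : s (x + 1) = true
  s2 : s (x + 2) = true
  s3 : s (x + 3) = false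
  t0 : t x = true
  t1 : t (x + 1) = false
  t2 : t (x + 2) = false
  t3 : t (x + 3) = true
  off : ∀ y, y < x ∨ x + 3 < y → s y = t y

/-- The equations that describe the ground states of `[c, d]`, for functions of the
occupation numbers. -/
structure Ground (lam : ℂ) (c d : ℤ) (f : (ℤ → Bool) → ℂ) : Prop where
  excl : ∀ s x, c ≤ x → x + 2 ≤ d → s x = true → s (x + 2) = true → f s = 0
  hop : ∀ s t x, c ≤ x → x + 3 ≤ d → HopPair x s t → f s = lam * f t

theorem num_num_apply {Λ : Finset ℤ} {x : ℤ} (h0 : x ∈ Λ) (h2 : x + 2 ∈ Λ) (v : Hilb Λ)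
    (s : ℤ → Bool) :
    (num Λ x * num Λ (x + 2)) v (res Λ s) = if s x ∧ s (x + 2) then v (res Λ s) else 0 := by
  rw [mul_apply_eq_comp, num_apply h0, num_apply h2, ite_and]

theorem hop_apply {Λ : Finset ℤ} {x : ℤ} (h0 : x ∈ Λ) (h1 : x + 1 ∈ Λ) (h2 : x + 2 ∈ Λ)
    (h3 : x + 3 ∈ Λ) (lam : ℂ) (v : Hilb Λ) (s : ℤ → Bool) :
    hop Λ lam x v (res Λ s) =
      (if s (x + 1) ∨ s (x + 2) then 0 else
        v (res Λ (Function.update (Function.update s (x + 1) true) (x + 2) true))) -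
      lam * (if s x ∨ s (x + 3) then 0 else
        v (res Λ (Function.update (Function.update s x true) (x + 3) true))) := by
  simp only [hop, sub_apply, smul_apply, mul_apply_eq_comp,
    PiLp.sub_apply, PiLp.smul_apply, smul_eq_mul, lower_apply h0, lower_apply h1]
  rw [lower_apply h2, lower_apply h3]
  cases s x <;> cases s (x + 1) <;> cases h : s (x + 2) <;> cases h' : s (x + 3) <;> simp [h, h']

theorem inner_self_eq_ofReal {E : Type*} [NormedAddCommGroup E] [InnerProductSpace ℂ E] (w : E) :
    inner ℂ w w = ((‖w‖ ^ 2 : ℝ) : ℂ) := by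
  rw [inner_self_eq_norm_sq_to_K, Complex.ofReal_pow]
  rfl

/-- Pairing with `v` turns the Hamiltonian into a sum of squared norms: a product of two occupation
numbers is a diagonal projection, the hopping terms have the form q*q, and κ > 0. Hence every
summand must vanish. -/
theorem ham_eq_zero_iff {Λ : Finset ℤ} {κ : ℝ} (hκ : 0 < κ) (lam : ℂ) {c d : ℤ}
    (hΛ : Finset.Icc c d ⊆ Λ) (v : Hilb Λ) :
    ham Λ κ lam c d v = 0 ↔
      (∀ x ∈ Finset.Icc c (d - 2), (num Λ x * num Λ (x + 2)) v = 0) ∧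
      ∀ x ∈ Finset.Icc c (d - 3), hop Λ lam x v = 0 := by
  have e : ham Λ κ lam c d v = ∑ x ∈ Finset.Icc c (d - 2), (num Λ x * num Λ (x + 2)) v +
      (κ : ℂ) • ∑ x ∈ Finset.Icc c (d - 3), star (hop Λ lam x) (hop Λ lam x v) := by
    simp only [ham, add_apply, smul_apply, sum_apply, mul_apply_eq_comp]
  constructor
  · intro h
    have h1 : ∀ x ∈ Finset.Icc c (d - 2),
        inner ℂ v ((num Λ x * num Λ (x + 2)) v) =
          ((‖(num Λ x * num Λ (x + 2)) v‖ ^ 2 : ℝ) : ℂ) := by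
      intro x hx
      rw [Finset.mem_Icc] at hx
      have m0 : x ∈ Λ := hΛ (Finset.mem_Icc.2 (by omega))
      have m2 : x + 2 ∈ Λ := hΛ (Finset.mem_Icc.2 (by omega))
      rw [← inner_self_eq_ofReal, PiLp.inner_apply, PiLp.inner_apply]
      refine Finset.sum_congr rfl fun σ _ => ?_
      rw [← res_ext Λ σ, num_num_apply m0 m2]
      split_ifs <;> simp
    have h2 : ∀ x ∈ Finset.Icc c (d - 3),
        inner ℂ v (star (hop Λ lam x) (hop Λ lam x v)) =
          ((‖hop Λ lam x v‖ ^ 2 : ℝ) : ℂ) := by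
      intro x _
      rw [← inner_self_eq_ofReal, ContinuousLinearMap.star_eq_adjoint, ContinuousLinearMap.adjoint_inner_right]
    have h3 : (∑ x ∈ Finset.Icc c (d - 2), ‖(num Λ x * num Λ (x + 2)) v‖ ^ 2) +
        κ * ∑ x ∈ Finset.Icc c (d - 3), ‖hop Λ lam x v‖ ^ 2 = 0 := by
      have h4 : inner ℂ v (ham Λ κ lam c d v) = 0 := by rw [h, inner_zero_right]
      rw [e, inner_add_right, inner_smul_right, inner_sum, inner_sum, Finset.sum_congr rfl h1,
        Finset.sum_congr rfl h2] at h4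
      apply Complex.ofReal_injective
      rw [Complex.ofReal_zero, ← h4]
      push_cast
      rfl
    have p1 : 0 ≤ ∑ x ∈ Finset.Icc c (d - 2), ‖(num Λ x * num Λ (x + 2)) v‖ ^ 2 :=
      Finset.sum_nonneg fun _ _ => by positivity
    have p2 : 0 ≤ ∑ x ∈ Finset.Icc c (d - 3), ‖hop Λ lam x v‖ ^ 2 :=
      Finset.sum_nonneg fun _ _ => by positivity
    have z1 : ∑ x ∈ Finset.Icc c (d - 2), ‖(num Λ x * num Λ (x + 2)) v‖ ^ 2 = 0 := by
      nlinarith [mul_nonneg hκ.le p2]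
    have z2 : ∑ x ∈ Finset.Icc c (d - 3), ‖hop Λ lam x v‖ ^ 2 = 0 := by
      have : κ * ∑ x ∈ Finset.Icc c (d - 3), ‖hop Λ lam x v‖ ^ 2 = 0 := by linarith
      exact (mul_eq_zero.1 this).resolve_left hκ.ne'
    rw [Finset.sum_eq_zero_iff_of_nonneg fun _ _ => by positivity] at z1 z2
    exact ⟨fun x hx => by simpa using z1 x hx, fun x hx => by simpa using z2 x hx⟩
  · rintro ⟨h1, h2⟩
    rw [e, Finset.sum_eq_zero h1, Finset.sum_eq_zero, smul_zero, add_zero]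
    intro x hx
    rw [h2 x hx, map_zero]

theorem ground_of_ham_eq_zero {Λ : Finset ℤ} {κ : ℝ} (hκ : 0 < κ) {lam : ℂ} {c d : ℤ}
    (hΛ : Finset.Icc c d ⊆ Λ) {v : Hilb Λ} (h : ham Λ κ lam c d v = 0) :
    Ground lam c d fun s => v (res Λ s) := by
  rw [ham_eq_zero_iff hκ lam hΛ] at h
  obtain ⟨h1, h2⟩ := h
  constructor
  · intro s x hc hd s0 s2
    have := congrArg (fun w : Hilb Λ => w (res Λ s)) (h1 x (Finset.mem_Icc.2 (by omega)))
    simp only at this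
    rw [num_num_apply (hΛ (Finset.mem_Icc.2 (by omega))) (hΛ (Finset.mem_Icc.2 (by omega)))] at this
    simpa [s0, s2] using this
  · intro s t x hc hd hst
    -- `w` is `s` with the pair on the middle sites removed; the two annihilation terms of `hop` at
    -- `w` evaluate the vector at `s` and at `t`.
    let w : ℤ → Bool := Function.update (Function.update s (x + 1) false) (x + 2) false
    have := congrArg (fun u : Hilb Λ => u (res Λ w)) (h2 x (Finset.mem_Icc.2 (by omega)))
    simp only at this
    rw [hop_apply (hΛ (Finset.mem_Icc.2 (by omega))) (hΛ (Finset.mem_Icc.2 (by omega)))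
      (hΛ (Finset.mem_Icc.2 (by omega))) (hΛ (Finset.mem_Icc.2 (by omega)))] at this
    have ws : Function.update (Function.update w (x + 1) true) (x + 2) true = s := by
      funext y
      simp only [w, Function.update_apply]
      have := hst.s1
      have := hst.s2
      split_ifs <;> simp_all
    have wt : Function.update (Function.update w x true) (x + 3) true = t := by
      funext y
      simp only [w, Function.update_apply]
      have := hst.t0
      have := hst.t1
      have := hst.t2
      have := hst.t3
      have := hst.off y
      split_ifs with i1 i2 i3 i4
      · simp_all
      · simp_all
      · simp_all
      · simp_all
      · exact this (by omega)
    rw [ws, wt] at this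
    have e0 : w x = false := by simp [w, hst.s0]
    have e3 : w (x + 3) = false := by simp [w, hst.s3]
    have e1 : w (x + 1) = false := by simp [w]
    have e2 : w (x + 2) = false := by simp [w]
    simpa [e0, e1, e2, e3, sub_eq_zero] using this

theorem ham_eq_zero_of_ground {Λ : Finset ℤ} {κ : ℝ} (hκ : 0 < κ) {lam : ℂ} {c d : ℤ}
    (hΛ : Finset.Icc c d ⊆ Λ) {f : (ℤ → Bool) → ℂ} (hf : Ground lam c d f)
    {v : Hilb Λ} (hv : ∀ s : ℤ → Bool, (∀ y, s y = true → y ∈ Λ) → v (res Λ s) = f s) :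
    ham Λ κ lam c d v = 0 := by
  rw [ham_eq_zero_iff hκ lam hΛ]
  have hext : ∀ σ y, ext Λ σ y = true → y ∈ Λ := by
    intro σ y h
    by_contra hc
    simp [ext, hc] at h
  constructor
  · intro x hx
    rw [Finset.mem_Icc] at hx
    ext σ
    rw [← res_ext Λ σ,
      num_num_apply (hΛ (Finset.mem_Icc.2 (by omega))) (hΛ (Finset.mem_Icc.2 (by omega)))]
    split_ifs with h
    · rw [hv _ (hext σ), hf.excl _ x (by omega) (by omega) h.1 h.2]; rfl
    · rfl
  · intro x hx
    rw [Finset.mem_Icc] at hx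
    have m0 : x ∈ Λ := hΛ (Finset.mem_Icc.2 (by omega))
    have m1 : x + 1 ∈ Λ := hΛ (Finset.mem_Icc.2 (by omega))
    have m2 : x + 2 ∈ Λ := hΛ (Finset.mem_Icc.2 (by omega))
    have m3 : x + 3 ∈ Λ := hΛ (Finset.mem_Icc.2 (by omega))
    ext σ
    rw [← res_ext Λ σ]
    have hs := hext σ
    generalize ext Λ σ = s at hs
    have hu : ∀ p ∈ Λ, ∀ q ∈ Λ, ∀ y,
        Function.update (Function.update s p true) q true y = true → y ∈ Λ := by
      intro p hp q hq y
      simp only [Function.update_apply]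
      split_ifs with h1 h2
      · rw [h1]; exact fun _ => hq
      · rw [h2]; exact fun _ => hp
      · exact hs y
    rw [hop_apply m0 m1 m2 m3, hv _ (hu _ m1 _ m2), hv _ (hu _ m0 _ m3)]
    set t := Function.update (Function.update s (x + 1) true) (x + 2) true with ht
    set w := Function.update (Function.update s x true) (x + 3) true with hw
    have t1 : t (x + 1) = true := by simp [ht]
    have t2 : t (x + 2) = true := by simp [ht]
    have t0 : t x = s x := by simp [ht]
    have t3 : t (x + 3) = s (x + 3) := by simp [ht]
    have w0 : w x = true := by simp [hw]
    have w3 : w (x + 3) = true := by simp [hw]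
    have w1 : w (x + 1) = s (x + 1) := by simp [hw]
    have w2 : w (x + 2) = s (x + 2) := by simp [hw]
    -- If only one of the two terms of `hop` is present, `s` has a particle next to the created pair
    -- or inside the created block, and exclusion kills that term.
    have f1 : s x = true ∨ s (x + 3) = true → f t = 0 := by
      rintro (h | h)
      · exact hf.excl t x (by omega) (by omega) (t0.trans h) t2
      · exact hf.excl t (x + 1) (by omega) (by omega) t1
          (by rw [show x + 1 + 2 = x + 3 by ring]; exact t3.trans h)
    have f2 : s (x + 1) = true ∨ s (x + 2) = true → f w = 0 := by
      rintro (h | h)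
      · exact hf.excl w (x + 1) (by omega) (by omega) (w1.trans h)
          (by rw [show x + 1 + 2 = x + 3 by ring]; exact w3)
      · exact hf.excl w x (by omega) (by omega) w0 (w2.trans h)
    rw [PiLp.zero_apply]
    by_cases i1 : s (x + 1) = true ∨ s (x + 2) = true <;>
      by_cases i2 : s x = true ∨ s (x + 3) = true
    · rw [if_pos i1, if_pos i2]; ring
    · rw [if_pos i1, if_neg i2, f2 i1]; ring
    · rw [if_neg i1, if_pos i2, f1 i2]; ring
    · rw [if_neg i1, if_neg i2, sub_eq_zero]
      push Not at i1 i2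
      simp only [ne_eq, Bool.not_eq_true] at i1 i2
      refine hf.hop t w x (by omega) (by omega) ⟨t0.trans i2.1, t1, t2, t3.trans i2.2, w0,
        w1.trans i1.1, w2.trans i1.2, w3, fun y hy => ?_⟩
      simp only [ht, hw, Function.update_apply]
      rw [if_neg (by omega), if_neg (by omega), if_neg (by omega), if_neg (by omega)]

/-! ### Products of projections -/

/-- A bilinear criterion for the norm of a product of three projections. -/
theorem norm_proj_mul_sq_le {E : Type*} [NormedAddCommGroup E] [InnerProductSpace ℂ E]
    [FiniteDimensional ℂ E] (V₁ V₂ V : Submodule ℂ E) (hV : V ≤ V₁) {F : ℝ} (hF : 0 ≤ F)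
    (h : ∀ f ∈ V₁, f ∈ Vᗮ → ∀ g ∈ V₂, ‖inner ℂ g f‖ ^ 2 ≤ F * ‖g‖ ^ 2 * ‖f‖ ^ 2) :
    ‖V₂.starProjection * (1 - V.starProjection) * V₁.starProjection‖ ^ 2 ≤ F := by
  have key : ‖V₂.starProjection * (1 - V.starProjection) * V₁.starProjection‖ ≤ √F := by
    refine ContinuousLinearMap.opNorm_le_bound _ (Real.sqrt_nonneg _) fun v => ?_
    simp only [mul_apply_eq_comp, sub_apply, one_apply_eq_self]
    set u := V₁.starProjection v with hu
    have hu1 : u ∈ V₁ := Submodule.starProjection_apply_mem _ _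
    set f := u - V.starProjection u with hf
    have hf1 : f ∈ V₁ := V₁.sub_mem hu1 (hV (Submodule.starProjection_apply_mem _ _))
    have hf2 : f ∈ Vᗮ := Submodule.sub_starProjection_mem_orthogonal _
    have hfn : ‖f‖ ≤ ‖v‖ := by
      have h1 : f = Vᗮ.starProjection u := by
        rw [Submodule.starProjection_orthogonal']; simp [hf]
      rw [h1]
      exact (Submodule.norm_starProjection_apply_le _ _).trans
        (Submodule.norm_starProjection_apply_le _ _)
    set g := V₂.starProjection f with hg
    have hg2 : g ∈ V₂ := Submodule.starProjection_apply_mem _ _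
    -- As `g` is the projection of `f`, ⟨g, f⟩ = ‖g‖², so the bilinear bound yields ‖g‖² ≤ F ‖f‖²
    -- after cancelling.
    have hin : inner ℂ g f = ((‖g‖ : ℝ) : ℂ) ^ 2 := by
      have h1 : inner ℂ g (f - g) = 0 :=
        Submodule.sub_starProjection_mem_orthogonal f g hg2
      rw [inner_sub_right, sub_eq_zero] at h1
      rw [h1, inner_self_eq_ofReal, Complex.ofReal_pow]
    have h3 := h f hf1 hf2 g hg2
    rw [hin, norm_pow, Complex.norm_real, norm_norm] at h3
    by_cases h0 : ‖g‖ = 0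
    · rw [h0]; positivity
    have hpos : 0 < ‖g‖ ^ 2 := by positivity
    have h4 : ‖g‖ ^ 2 ≤ F * ‖f‖ ^ 2 := by
      have : ‖g‖ ^ 2 * ‖g‖ ^ 2 ≤ ‖g‖ ^ 2 * (F * ‖f‖ ^ 2) := by nlinarith
      exact le_of_mul_le_mul_left this hpos
    calc ‖g‖ ≤ √F * ‖f‖ := by
          rw [← pow_le_pow_iff_left₀ (norm_nonneg _) (by positivity) two_ne_zero, mul_pow, Real.sq_sqrt hF]; exact h4
      _ ≤ _ := by gcongr
  calc _ ≤ √F ^ 2 := by gcongr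
    _ = F := Real.sq_sqrt hF


/-! ### Allowed configurations -/

/-- The occupation functions supported in `[a, b]` that avoid the patterns
`1?1`, `11??1`, `1??11` and `11???11`. -/
structure Allowed (a b : ℤ) (s : ℤ → Bool) : Prop where
  supp : ∀ y, s y = true → a ≤ y ∧ y ≤ b
  gap2 : ∀ y, s y = true → s (y + 2) = false
  pair_right : ∀ y, s y = true → s (y + 1) = true → s (y + 4) = false
  pair_left : ∀ y, s y = true → s (y + 3) = true → s (y + 4) = false
  pair_pair : ∀ y, s y = true → s (y + 1) = true → s (y + 5) = true → s (y + 6) = false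

/-- The neighbourhood of a block `0110` or `1001` on `x, …, x + 3` in an allowed configuration. -/
structure Surround (x : ℤ) (s : ℤ → Bool) : Prop where
  l1 : s (x - 1) = false
  l2 : s (x - 2) = false
  l34 : ¬ (s (x - 4) = true ∧ s (x - 3) = true)
  r1 : s (x + 4) = false
  r2 : s (x + 5) = false
  r34 : ¬ (s (x + 6) = true ∧ s (x + 7) = true)

theorem HopPair.surround_left {a b x : ℤ} {s t : ℤ → Bool} (h : HopPair x s t)
    (hs : Allowed a b s) : Surround x s := by
  obtain ⟨s0, s1, s2, s3, t0, t1, t2, t3, off⟩ := h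
  obtain ⟨supp, g, pr, pl, pp⟩ := hs
  have := g (x - 1)
  have := pl (x - 2)
  have := g (x + 2)
  have := pr (x + 1)
  have := pp (x - 4)
  have := pp (x + 1)
  constructor <;> grind

theorem HopPair.surround_right {a b x : ℤ} {s t : ℤ → Bool} (h : HopPair x s t)
    (ht : Allowed a b t) : Surround x t := by
  obtain ⟨s0, s1, s2, s3, t0, t1, t2, t3, off⟩ := h
  obtain ⟨supp, g, pr, pl, pp⟩ := ht
  have := pr (x - 1)
  have := g (x - 2)
  have := pl x
  have := g (x + 3)
  have := pr (x - 4)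
  have := pl (x + 3)
  constructor <;> grind

/-- On either side of the hop the forbidden patterns force the same neighbourhood (`Surround`), and
this neighbourhood is compatible with both 0110 and 1001. -/
theorem HopPair.allowed_iff {a b x : ℤ} {s t : ℤ → Bool} (h : HopPair x s t) (ha : a ≤ x)
    (hb : x + 3 ≤ b) : Allowed a b s ↔ Allowed a b t := by
  have h' := h
  obtain ⟨s0, s1, s2, s3, t0, t1, t2, t3, off⟩ := h
  have cases_y : ∀ y, y = x ∨ y = x + 1 ∨ y = x + 2 ∨ y = x + 3 ∨ s y = t y := by
    intro y
    by_cases hy : y < x ∨ x + 3 < y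
    · simp [off y hy]
    · omega
  constructor
  · intro hs
    obtain ⟨l1, l2, l34, r1, r2, r34⟩ := h'.surround_left hs
    obtain ⟨supp, g, pr, pl, pp⟩ := hs
    refine ⟨?_, ?_, ?_, ?_, ?_⟩
    · intro y
      have i := supp y
      have c0 := cases_y y
      clear supp g pr pl pp off cases_y
      grind (splits := 20)
    · intro y
      have i := g y
      have c0 := cases_y y
      have c1 := cases_y (y + 2)
      clear supp g pr pl pp off cases_y
      grind (splits := 20)
    · intro y
      have i := pr y
      have c0 := cases_y y
      have c1 := cases_y (y + 1)
      have c2 := cases_y (y + 4)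
      clear supp g pr pl pp off cases_y
      grind (splits := 20)
    · intro y
      have i := pl y
      have c0 := cases_y y
      have c1 := cases_y (y + 3)
      have c2 := cases_y (y + 4)
      clear supp g pr pl pp off cases_y
      grind (splits := 20)
    · intro y
      have i := pp y
      have c0 := cases_y y
      have c1 := cases_y (y + 1)
      have c2 := cases_y (y + 5)
      have c3 := cases_y (y + 6)
      clear supp g pr pl pp off cases_y
      grind (splits := 20)
  · intro ht
    obtain ⟨l1, l2, l34, r1, r2, r34⟩ := h'.surround_right ht
    obtain ⟨supp, g, pr, pl, pp⟩ := ht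
    refine ⟨?_, ?_, ?_, ?_, ?_⟩
    · intro y
      have i := supp y
      have c0 := cases_y y
      clear supp g pr pl pp off cases_y
      grind (splits := 20)
    · intro y
      have i := g y
      have c0 := cases_y y
      have c1 := cases_y (y + 2)
      clear supp g pr pl pp off cases_y
      grind (splits := 20)
    · intro y
      have i := pr y
      have c0 := cases_y y
      have c1 := cases_y (y + 1)
      have c2 := cases_y (y + 4)
      clear supp g pr pl pp off cases_y
      grind (splits := 20)
    · intro y
      have i := pl y
      have c0 := cases_y y
      have c1 := cases_y (y + 3)
      have c2 := cases_y (y + 4)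
      clear supp g pr pl pp off cases_y
      grind (splits := 20)
    · intro y
      have i := pp y
      have c0 := cases_y y
      have c1 := cases_y (y + 1)
      have c2 := cases_y (y + 5)
      have c3 := cases_y (y + 6)
      clear supp g pr pl pp off cases_y
      grind (splits := 20)

/-- Replaces the block on `x, …, x + 3` by the given one. -/
def setBlock (s : ℤ → Bool) (x : ℤ) (u : Bool) : ℤ → Bool := fun y =>
  if y = x ∨ y = x + 3 then u else if y = x + 1 ∨ y = x + 2 then !u else s y

namespace Ground
variable {lam : ℂ} {c d : ℤ} {f : (ℤ → Bool) → ℂ} (h : Ground lam c d f) {s : ℤ → Bool} {y : ℤ}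
include h

/-- Hopping the outer two of 11??1 inwards creates 1?1, whose amplitude is zero; dividing by `lam`
transfers the zero back. -/
theorem pair_right (hlam : lam ≠ 0) (hc : c ≤ y) (hd : y + 4 ≤ d) (h0 : s y = true)
    (h1 : s (y + 1) = true) (h4 : s (y + 4) = true) : f s = 0 := by
  by_cases h2 : s (y + 2) = true
  · exact h.excl s y hc (by omega) h0 h2
  by_cases h3 : s (y + 3) = true
  · exact h.excl s (y + 1) (by omega) (by omega) h1 (by grind)
  have hp : HopPair (y + 1) (setBlock s (y + 1) false) s := by
    constructor <;> grind [setBlock]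
  have e := h.hop _ _ (y + 1) (by omega) (by omega) hp
  rw [h.excl _ y hc (by omega) (by grind [setBlock]) (by grind [setBlock])] at e
  simpa [hlam] using e.symm

theorem pair_left (hlam : lam ≠ 0) (hc : c ≤ y) (hd : y + 4 ≤ d) (h0 : s y = true)
    (h3 : s (y + 3) = true) (h4 : s (y + 4) = true) : f s = 0 := by
  by_cases h1 : s (y + 1) = true
  · exact h.excl s (y + 1) (by omega) (by omega) h1 (by grind)
  by_cases h2 : s (y + 2) = true
  · exact h.excl s y (by omega) (by omega) h0 h2
  have hp : HopPair y (setBlock s y false) s := by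
    constructor <;> grind [setBlock]
  have e := h.hop _ _ y (by omega) (by omega) hp
  rw [h.excl _ (y + 2) (by omega) (by omega) (by grind [setBlock]) (by grind [setBlock])] at e
  simpa [hlam] using e.symm

/-- Spreading one of the pairs in 11???11 outwards reduces to 11??1 or 1??11. This needs one more
site of the interval on one side, hence at least eight sites. -/
theorem pair_pair (hlam : lam ≠ 0) (hc : c ≤ y) (hd : y + 6 ≤ d) (hcd : 7 ≤ d - c)
    (h0 : s y = true) (h1 : s (y + 1) = true) (h5 : s (y + 5) = true) (h6 : s (y + 6) = true) :
    f s = 0 := by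
  by_cases hy : y + 7 ≤ d
  · by_cases h7 : s (y + 7) = true
    · exact h.excl s (y + 5) (by omega) (by omega) h5 (by grind)
    by_cases h4 : s (y + 4) = true
    · exact h.excl s (y + 4) (by omega) (by omega) h4 (by grind)
    have hp : HopPair (y + 4) s (setBlock s (y + 4) true) := by
      constructor <;> grind [setBlock]
    rw [h.hop _ _ (y + 4) (by omega) (by omega) hp, h.pair_right hlam hc (by omega)
      (by grind [setBlock]) (by grind [setBlock]) (by grind [setBlock]), mul_zero]
  · by_cases h7 : s (y - 1) = true
    · exact h.excl s (y - 1) (by omega) (by omega) h7 (by grind)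
    by_cases h4 : s (y + 2) = true
    · exact h.excl s y (by omega) (by omega) h0 h4
    have hp : HopPair (y - 1) s (setBlock s (y - 1) true) := by
      constructor <;> grind [setBlock]
    rw [h.hop _ _ (y - 1) (by omega) (by omega) hp, h.pair_left (y := y + 2) hlam (by omega)
      (by omega) (by grind [setBlock]) (by grind [setBlock]) (by grind [setBlock]), mul_zero]

end Ground

/-- A forbidden pattern has at most seven sites. If it does not fit into [a, b-3] it ends at b-2 or
later, so it starts at b-8 or later and lies in the last nine sites. -/
theorem Ground.allowed {lam : ℂ} (hlam : lam ≠ 0) {a b : ℤ} (hab : 10 ≤ b - a)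
    {f g : (ℤ → Bool) → ℂ} (hf : Ground lam a (b - 3) f) (hg : Ground lam (b - 8) b g)
    {s : ℤ → Bool} (supp : ∀ y, s y = true → a ≤ y ∧ y ≤ b) (hfs : f s ≠ 0) (hgs : g s ≠ 0) :
    Allowed a b s := by
  refine ⟨supp, fun y h0 => ?_, fun y h0 h1 => ?_, fun y h0 h3 => ?_, fun y h0 h1 h5 => ?_⟩ <;>
    rw [← Bool.not_eq_true] <;> intro hh <;> have i0 := supp _ h0 <;> have i1 := supp _ hh
  · by_cases hy : y + 2 ≤ b - 3
    · exact hfs (hf.excl s y (by omega) hy h0 hh)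
    · exact hgs (hg.excl s y (by omega) (by omega) h0 hh)
  · by_cases hy : y + 4 ≤ b - 3
    · exact hfs (hf.pair_right hlam (by omega) hy h0 h1 hh)
    · exact hgs (hg.pair_right hlam (by omega) (by omega) h0 h1 hh)
  · by_cases hy : y + 4 ≤ b - 3
    · exact hfs (hf.pair_left hlam (by omega) hy h0 h3 hh)
    · exact hgs (hg.pair_left hlam (by omega) (by omega) h0 h3 hh)
  · by_cases hy : y + 6 ≤ b - 3
    · exact hfs (hf.pair_pair hlam (by omega) hy (by omega) h0 h1 h5 hh)
    · exact hgs (hg.pair_pair hlam (by omega) (by omega) (by omega) h0 h1 h5 hh)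


/-! ### Reading and writing dominoes from right to left -/

/-- A monomer of `s` ends at the site `p`. -/
abbrev MonomerAt (s : ℤ → Bool) (p : ℤ) : Prop :=
  s (p - 2) = true ∧ s (p - 1) = false ∧ s p = false

/-- A dimer of `s` ends at the site `p`. -/
abbrev DimerAt (s : ℤ → Bool) (p : ℤ) : Prop :=
  s (p - 5) = false ∧ s (p - 4) = true ∧ s (p - 3) = true ∧ s (p - 2) = false ∧
    s (p - 1) = false ∧ s p = false

/-- The dominoes of `s` read from the site `p` to the left, not beyond the site `a`. -/
def parse (a : ℤ) (s : ℤ → Bool) (p : ℤ) : List Domino :=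
  if _h : a ≤ p - 2 ∧ MonomerAt s p then .monomer :: parse a s (p - 3)
  else if _h : a ≤ p - 5 ∧ DimerAt s p then .dimer :: parse a s (p - 6) else []
termination_by (p + 1 - a).toNat
decreasing_by all_goals omega

/-- Writes dominoes over `s`, from the site `p` to the left. -/
def lay (s : ℤ → Bool) : ℤ → List Domino → ℤ → Bool
  | _, [], y => s y
  | p, .monomer :: D, y => if p - 3 < y ∧ y ≤ p then decide (y = p - 2) else lay s (p - 3) D y
  | p, .dimer :: D, y =>
    if p - 6 < y ∧ y ≤ p then decide (y = p - 4 ∨ y = p - 3) else lay s (p - 6) D y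

theorem lay_monomer (s : ℤ → Bool) (p y : ℤ) (D : List Domino) :
    lay s p (.monomer :: D) y =
      if p - 3 < y ∧ y ≤ p then decide (y = p - 2) else lay s (p - 3) D y := rfl

theorem lay_dimer (s : ℤ → Bool) (p y : ℤ) (D : List Domino) :
    lay s p (.dimer :: D) y =
      if p - 6 < y ∧ y ≤ p then decide (y = p - 4 ∨ y = p - 3) else lay s (p - 6) D y := rfl

theorem parse_monomer {a p : ℤ} {s : ℤ → Bool} (h : a ≤ p - 2) (hs : MonomerAt s p) :
    parse a s p = .monomer :: parse a s (p - 3) := by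
  rw [parse, dif_pos ⟨h, hs⟩]

theorem parse_dimer {a p : ℤ} {s : ℤ → Bool} (h : a ≤ p - 5) (hs : DimerAt s p) :
    parse a s p = .dimer :: parse a s (p - 6) := by
  rw [parse, dif_neg, dif_pos ⟨h, hs⟩]
  rintro ⟨_, h1, _⟩
  rw [hs.2.2.2.1] at h1
  cases h1

theorem parse_nil {a p : ℤ} {s : ℤ → Bool} (h1 : ¬ (a ≤ p - 2 ∧ MonomerAt s p))
    (h2 : ¬ (a ≤ p - 5 ∧ DimerAt s p)) : parse a s p = [] := by
  rw [parse, dif_neg h1, dif_neg h2]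

/-- Induction along the dominoes read from right to left. -/
theorem parse_induction (a : ℤ) (s : ℤ → Bool) {motive : ℤ → Prop}
    (monomer : ∀ p, a ≤ p - 2 → MonomerAt s p → motive (p - 3) → motive p)
    (dimer : ∀ p, a ≤ p - 5 → DimerAt s p → motive (p - 6) → motive p)
    (done_reading : ∀ p, ¬ (a ≤ p - 2 ∧ MonomerAt s p) → ¬ (a ≤ p - 5 ∧ DimerAt s p) → motive p)
    (p : ℤ) : motive p := by
  by_cases h1 : a ≤ p - 2 ∧ MonomerAt s p
  · exact monomer p h1.1 h1.2 (parse_induction a s monomer dimer done_reading (p - 3))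
  by_cases h2 : a ≤ p - 5 ∧ DimerAt s p
  · exact dimer p h2.1 h2.2 (parse_induction a s monomer dimer done_reading (p - 6))
  exact done_reading p h1 h2
termination_by (p + 1 - a).toNat
decreasing_by all_goals omega

theorem lay_off (s : ℤ → Bool) : ∀ (D : List Domino) (p y : ℤ),
    p < y ∨ y ≤ p - 3 * cells D → lay s p D y = s y
  | [], _, _, _ => rfl
  | .monomer :: D, p, y, h => by
    simp only [cells] at h
    push_cast at h
    rw [lay, if_neg (by omega), lay_off s D _ _ (by omega)]
  | .dimer :: D, p, y, h => by
    simp only [cells] at h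
    push_cast at h
    rw [lay, if_neg (by omega), lay_off s D _ _ (by omega)]

theorem lay_congr {s t : ℤ → Bool} : ∀ (D : List Domino) (p y : ℤ),
    (p < y ∨ y ≤ p - 3 * cells D → s y = t y) → lay s p D y = lay t p D y
  | [], p, y, h => h (by simp [cells]; omega)
  | .monomer :: D, p, y, h => by
    simp only [cells] at h
    push_cast at h
    rw [lay, lay]
    split_ifs with i
    · rfl
    · exact lay_congr D _ _ fun hy => h (by omega)
  | .dimer :: D, p, y, h => by
    simp only [cells] at h
    push_cast at h
    rw [lay, lay]
    split_ifs with i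
    · rfl
    · exact lay_congr D _ _ fun hy => h (by omega)

theorem lay_lay (s : ℤ → Bool) (p : ℤ) (D E : List Domino) (h : cells D = cells E) :
    lay (lay s p D) p E = lay s p E := by
  funext y
  apply lay_congr
  intro hy
  exact lay_off s D p y (by rwa [h])

theorem parse_congr {a p : ℤ} {s t : ℤ → Bool} : (∀ y ≤ p, s y = t y) → parse a s p = parse a t p := by
  induction p using parse_induction a s with
  | monomer p h1 h2 ih =>
    intro h
    have h3 : MonomerAt t p := by
      simpa only [MonomerAt, ← h _ (show p - 2 ≤ p by omega), ← h _ (show p - 1 ≤ p by omega),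
        ← h p le_rfl] using h2
    rw [parse_monomer h1 h2, parse_monomer h1 h3, ih fun y hy => h y (by omega)]
  | dimer p h1 h2 ih =>
    intro h
    have h3 : DimerAt t p := by
      simpa only [DimerAt, ← h _ (show p - 2 ≤ p by omega), ← h _ (show p - 1 ≤ p by omega),
        ← h _ (show p - 3 ≤ p by omega), ← h _ (show p - 4 ≤ p by omega),
        ← h _ (show p - 5 ≤ p by omega), ← h p le_rfl] using h2
    rw [parse_dimer h1 h2, parse_dimer h1 h3, ih fun y hy => h y (by omega)]
  | done_reading p h1 h2 =>
    intro h
    rw [parse_nil h1 h2, parse_nil]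
    · simpa only [MonomerAt, ← h _ (show p - 2 ≤ p by omega), ← h _ (show p - 1 ≤ p by omega),
        ← h p le_rfl] using h1
    · simpa only [DimerAt, ← h _ (show p - 2 ≤ p by omega), ← h _ (show p - 1 ≤ p by omega),
        ← h _ (show p - 3 ≤ p by omega), ← h _ (show p - 4 ≤ p by omega),
        ← h _ (show p - 5 ≤ p by omega), ← h p le_rfl] using h2

theorem parse_lay (a : ℤ) (s : ℤ → Bool) : ∀ (D : List Domino) (p : ℤ), a ≤ p - 3 * cells D + 1 →
    parse a (lay s p D) p = D ++ parse a s (p - 3 * cells D)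
  | [], p, _ => by simp [cells]; rfl
  | .monomer :: D, p, h => by
    simp only [cells] at h ⊢
    push_cast at h ⊢
    rw [parse_monomer (by omega) (by simp [MonomerAt, lay]; omega), List.cons_append,
      show p - 3 * ((cells D : ℤ) + 1) = p - 3 - 3 * cells D by ring,
      ← parse_lay a s D (p - 3) (by omega)]
    congr 1
    apply parse_congr
    intro y hy
    rw [lay, if_neg (by omega)]
  | .dimer :: D, p, h => by
    simp only [cells] at h ⊢
    push_cast at h ⊢
    rw [parse_dimer (by omega) (by simp [DimerAt, lay]; omega), List.cons_append,
      show p - 3 * ((cells D : ℤ) + 2) = p - 6 - 3 * cells D by ring,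
      ← parse_lay a s D (p - 6) (by omega)]
    congr 1
    apply parse_congr
    intro y hy
    rw [lay, if_neg (by omega)]

theorem lay_parse (a : ℤ) (s : ℤ → Bool) (p : ℤ) : lay s p (parse a s p) = s := by
  induction p using parse_induction a s with
  | monomer p h1 h2 ih =>
    rw [parse_monomer h1 h2]
    funext y
    rw [lay, ih]
    obtain ⟨i1, i2, i3⟩ := h2
    split_ifs with hy
    · obtain rfl | rfl | rfl : y = p - 2 ∨ y = p - 1 ∨ y = p := by omega
      all_goals simp [*] <;> omega
    · rfl
  | dimer p h1 h2 ih =>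
    rw [parse_dimer h1 h2]
    funext y
    rw [lay, ih]
    obtain ⟨i1, i2, i3, i4, i5, i6⟩ := h2
    split_ifs with hy
    · obtain rfl | rfl | rfl | rfl | rfl | rfl : y = p - 5 ∨ y = p - 4 ∨ y = p - 3 ∨
        y = p - 2 ∨ y = p - 1 ∨ y = p := by omega
      all_goals simp [*] <;> omega
    · rfl
  | done_reading p h1 h2 =>
    rw [parse_nil h1 h2]
    rfl

theorem cells_parse_le (a : ℤ) (s : ℤ → Bool) (p : ℤ) :
    a - 1 ≤ p → a ≤ p - 3 * cells (parse a s p) + 1 := by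
  induction p using parse_induction a s with
  | monomer p h1 h2 ih =>
    intro _
    rw [parse_monomer h1 h2, cells]
    push_cast
    have := ih (by omega)
    omega
  | dimer p h1 h2 ih =>
    intro _
    rw [parse_dimer h1 h2, cells]
    push_cast
    have := ih (by omega)
    omega
  | done_reading p h1 h2 =>
    intro h
    rw [parse_nil h1 h2, cells]
    push_cast
    omega

theorem HopPair.overwrite {x l u : ℤ} {s t : ℤ → Bool} (h : HopPair x s t) (hx : x + 3 ≤ l)
    (w : ℤ → Bool) : HopPair x (fun y => if l < y ∧ y ≤ u then w y else s y)
      (fun y => if l < y ∧ y ≤ u then w y else t y) := by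
  obtain ⟨s0, s1, s2, s3, t0, t1, t2, t3, off⟩ := h
  refine ⟨?_, ?_, ?_, ?_, ?_, ?_, ?_, ?_, ?_⟩
  iterate 8 rw [if_neg (by omega)]; assumption
  intro y hy
  simp only [off y hy]

/-- A dimer reads 011000 and two monomers read 100100, so exchanging them is a hop on a block that
starts five sites before their common end. -/
theorem hopPair_lay (s : ℤ → Bool) (Q : List Domino) : ∀ (P : List Domino) (p : ℤ),
    HopPair (p - 3 * cells P - 5) (lay s p (P ++ .dimer :: Q))
      (lay s p (P ++ .monomer :: .monomer :: Q))
  | [], p => by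
    simp only [cells, List.nil_append]
    push_cast
    refine ⟨?_, ?_, ?_, ?_, ?_, ?_, ?_, ?_, ?_⟩
    iterate 4
      rw [lay, if_pos (by omega)]
      simp only [decide_eq_true_eq, decide_eq_false_iff_not]
      omega
    iterate 3
      rw [lay, if_neg (by omega), lay, if_pos (by omega)]
      simp only [decide_eq_true_eq, decide_eq_false_iff_not]
      omega
    · rw [lay, if_pos (by omega)]
      simp only [decide_eq_true_eq]
      omega
    · intro y hy
      by_cases h1 : p - 6 < y ∧ y ≤ p
      · rw [lay_dimer, if_pos h1, lay_monomer]
        by_cases h2 : p - 3 < y ∧ y ≤ p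
        · rw [if_pos h2, decide_eq_decide]
          omega
        · rw [if_neg h2, lay_monomer, if_pos (by omega), decide_eq_decide]
          omega
      · rw [lay_dimer, if_neg h1, lay_monomer, if_neg (by omega), lay_monomer, if_neg (by omega),
          show p - 3 - 3 = p - 6 by ring]
  | .monomer :: P, p => by
    have := (hopPair_lay s Q P (p - 3)).overwrite (l := p - 3) (u := p) (by omega)
      fun y => decide (y = p - 2)
    simp only [cells, List.cons_append]
    push_cast
    rw [show p - 3 * ((cells P : ℤ) + 1) - 5 = p - 3 - 3 * cells P - 5 by ring]
    exact this
  | .dimer :: P, p => by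
    have := (hopPair_lay s Q P (p - 6)).overwrite (l := p - 6) (u := p) (by omega)
      fun y => decide (y = p - 4 ∨ y = p - 3)
    simp only [cells, List.cons_append]
    push_cast
    rw [show p - 3 * ((cells P : ℤ) + 2) - 5 = p - 6 - 3 * cells P - 5 by ring]
    exact this

theorem HopPair.lay {x : ℤ} {s t : ℤ → Bool} (h : HopPair x s t) : ∀ (D : List Domino) (p : ℤ),
    x + 3 ≤ p - 3 * cells D → HopPair x (lay s p D) (lay t p D)
  | [], _, _ => h
  | .monomer :: D, p, hp => by
    simp only [cells] at hp
    push_cast at hp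
    exact (h.lay D (p - 3) (by omega)).overwrite (l := p - 3) (u := p) (by omega)
      fun y => decide (y = p - 2)
  | .dimer :: D, p, hp => by
    simp only [cells] at hp
    push_cast at hp
    exact (h.lay D (p - 6) (by omega)).overwrite (l := p - 6) (u := p) (by omega)
      fun y => decide (y = p - 4 ∨ y = p - 3)

/-- No domino read from the right can straddle the cut after `x + 5`. Reading therefore either stops
before the block is reached or arrives exactly at `x + 5`, where `s` shows a dimer and `t` two
monomers. -/
theorem HopPair.parse {a x : ℤ} {s t : ℤ → Bool} (h : HopPair x s t) (hs : Surround x s)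
    (ht : Surround x t) (ha : a ≤ x) (p : ℤ) : x + 5 ≤ p →
    (x + 5 ≤ p - 3 * cells (FQH.parse a s p) ∧ FQH.parse a s p = FQH.parse a t p) ∨
    ∃ P Q, FQH.parse a s p = P ++ .dimer :: Q ∧
      FQH.parse a t p = P ++ .monomer :: .monomer :: Q ∧ p = x + 5 + 3 * cells P := by
  obtain ⟨s0, s1, s2, s3, t0, t1, t2, t3, off⟩ := id h
  have hr1 := hs.r1
  have hr2 := hs.r2
  have hr34 := hs.r34
  have htr1 := ht.r1
  have htr2 := ht.r2
  have htr34 := ht.r34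
  -- A domino that ends to the right of `x + 5` also starts there: otherwise it would need a
  -- particle on a vacant site around the block, or the pair on `x + 6`, `x + 7` that `Surround`
  -- forbids.
  have bM : ∀ q, x + 6 ≤ q → MonomerAt s q ∨ MonomerAt t q → x + 8 ≤ q := by
    intro q hq hm
    by_contra hc
    obtain rfl | rfl : q = x + 6 ∨ q = x + 7 := by omega
    all_goals clear off; simp only [MonomerAt] at hm; grind
  have bD : ∀ q, x + 6 ≤ q → DimerAt s q ∨ DimerAt t q → x + 11 ≤ q := by
    intro q hq hm
    by_contra hc
    obtain rfl | rfl | rfl | rfl | rfl : q = x + 6 ∨ q = x + 7 ∨ q = x + 8 ∨ q = x + 9 ∨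
      q = x + 10 := by omega
    all_goals clear off; simp only [DimerAt] at hm; grind
  have eM : ∀ q, x + 8 ≤ q → (MonomerAt s q ↔ MonomerAt t q) := by
    intro q hq
    simp only [MonomerAt, off q (by omega), off (q - 1) (by omega), off (q - 2) (by omega)]
  have eD : ∀ q, x + 11 ≤ q → (DimerAt s q ↔ DimerAt t q) := by
    intro q hq
    simp only [DimerAt, off q (by omega), off (q - 1) (by omega), off (q - 2) (by omega),
      off (q - 3) (by omega), off (q - 4) (by omega), off (q - 5) (by omega)]
  have start : DimerAt s (x + 5) ∧ MonomerAt t (x + 5) ∧ MonomerAt t (x + 2) := by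
    clear off
    simp only [DimerAt, MonomerAt]
    grind
  have base : FQH.parse a s (x + 5) = .dimer :: FQH.parse a s (x - 1) ∧
      FQH.parse a t (x + 5) = .monomer :: .monomer :: FQH.parse a s (x - 1) := by
    refine ⟨?_, ?_⟩
    · rw [parse_dimer (by omega) start.1, show x + 5 - 6 = x - 1 by ring]
    · rw [parse_monomer (by omega) start.2.1, show x + 5 - 3 = x + 2 by ring,
        parse_monomer (by omega) start.2.2, show x + 2 - 3 = x - 1 by ring,
        parse_congr fun y hy => (off y (by omega)).symm]
  induction p using parse_induction a s with
  | monomer p h1 h2 ih =>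
    intro hp
    rcases eq_or_lt_of_le hp with rfl | hp
    · exact Or.inr ⟨[], _, base.1, base.2, by simp [cells]⟩
    have hp8 := bM p (by omega) (Or.inl h2)
    rw [parse_monomer h1 h2, parse_monomer h1 ((eM p hp8).1 h2), cells]
    rcases ih (by omega) with ⟨i1, i2⟩ | ⟨P, Q, i1, i2, i3⟩
    · left
      push_cast
      exact ⟨by omega, by rw [i2]⟩
    · right
      exact ⟨.monomer :: P, Q, by rw [i1]; rfl, by rw [i2]; rfl, by simp only [cells]; push_cast; omega⟩
  | dimer p h1 h2 ih =>
    intro hp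
    rcases eq_or_lt_of_le hp with rfl | hp
    · exact Or.inr ⟨[], _, base.1, base.2, by simp [cells]⟩
    have hp8 := bD p (by omega) (Or.inl h2)
    rw [parse_dimer h1 h2, parse_dimer h1 ((eD p hp8).1 h2), cells]
    rcases ih (by omega) with ⟨i1, i2⟩ | ⟨P, Q, i1, i2, i3⟩
    · left
      push_cast
      exact ⟨by omega, by rw [i2]⟩
    · right
      exact ⟨.dimer :: P, Q, by rw [i1]; rfl, by rw [i2]; rfl, by simp only [cells]; push_cast; omega⟩
  | done_reading p h1 h2 =>
    intro hp
    rcases eq_or_lt_of_le hp with rfl | hp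
    · exact Or.inr ⟨[], _, base.1, base.2, by simp [cells]⟩
    left
    rw [parse_nil h1 h2, parse_nil]
    · exact ⟨by simpa [cells] using hp.le, rfl⟩
    · rintro ⟨h3, h4⟩
      exact h1 ⟨h3, (eM p (bM p (by omega) (Or.inr h4))).2 h4⟩
    · rintro ⟨h3, h4⟩
      exact h2 ⟨h3, (eD p (bD p (by omega) (Or.inr h4))).2 h4⟩

/-- Reading from a site that cuts the block of a hopping pair, there is at most one cell. -/
theorem HopPair.cells_parse_lt {a x p : ℤ} {s t : ℤ → Bool} (h : HopPair x s t)
    (hp : p = x + 3 ∨ p = x + 4) :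
    cells (FQH.parse a s p) < 2 ∧ cells (FQH.parse a t p) < 2 := by
  obtain ⟨s0, s1, s2, s3, t0, t1, t2, t3, -⟩ := h
  have nil : ∀ u q, ¬ MonomerAt u q → ¬ DimerAt u q → cells (FQH.parse a u q) = 0 := by
    intro u q h1 h2
    rw [parse_nil (fun h => h1 h.2) (fun h => h2 h.2), cells]
  rcases hp with rfl | rfl
  · rw [nil s, nil t]
    · simp
    all_goals simp only [MonomerAt, DimerAt]; grind
  · rw [nil t]
    · refine ⟨?_, by simp⟩
      by_cases h1 : a ≤ x + 4 - 2 ∧ MonomerAt s (x + 4)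
      · rw [parse_monomer h1.1 h1.2, cells, nil s]
        · simp
        all_goals simp only [MonomerAt, DimerAt]; grind
      · rw [parse_nil h1]
        · simp [cells]
        · simp only [DimerAt]; grind
    all_goals simp only [MonomerAt, DimerAt]; grind

/-! ### The estimate in one sector -/

open Domino

theorem cells_append (D E : List Domino) : cells (D ++ E) = cells D + cells E := by
  induction D with
  | nil => simp [cells]
  | cons T D ih => cases T <;> simp [cells, ih] <;> ring

@[simp] theorem cells_replicate (n : ℕ) : cells (List.replicate n monomer) = n := by
  induction n with
  | zero => rfl
  | succ n ih => rw [List.replicate_succ, cells, ih]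

@[simp] theorem dimers_replicate (n : ℕ) : dimers (List.replicate n monomer) = 0 := by
  induction n with
  | zero => rfl
  | succ n ih => rw [List.replicate_succ, dimers, ih]

/-- Cauchy-Schwarz with weights `u` and `v`, which will be the multiplicities 1 + 2r and 1 + r of
the two groups of amplitudes of `X`. -/
theorem sq_add_le_of_sq_le {p q u v P Q U V : ℝ} (hu : 0 < u)
    (hv : 0 < v) (hU : 0 ≤ U) (hV : 0 ≤ V) (h1 : p ^ 2 ≤ P * U) (h2 : q ^ 2 ≤ Q * V)
    (hP : 0 ≤ P) (hQ : 0 ≤ Q) : (p + q) ^ 2 ≤ (P / u + Q / v) * (u * U + v * V) := by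
  have e : (P / u + Q / v) * (u * U + v * V) = P * U + Q * V + (P * V * (v / u) + Q * U * (u / v)) := by
    field_simp
    ring
  have h3 : 2 * (p * q) ≤ P * V * (v / u) + Q * U * (u / v) := by
    apply le_of_sq_le_sq _ (by positivity)
    have i1 : (p * q) ^ 2 ≤ (P * V * (v / u)) * (Q * U * (u / v)) := by
      have : (P * V * (v / u)) * (Q * U * (u / v)) = (P * U) * (Q * V) := by
        field_simp
      rw [this, mul_pow]
      exact mul_le_mul h1 h2 (by positivity) (by positivity)
    nlinarith [sq_nonneg (P * V * (v / u) - Q * U * (u / v))]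
  rw [e]
  nlinarith

/-- The sectorwise bound behind the norm estimate: `F` is the restriction of a ground state of the
left part and `X` that of a ground state of the last nine sites to the tilings of `n` cells, read
from right to left. -/
theorem sector_bound {lam : ℂ} (hlam : lam ≠ 0) {M : ℝ} (hM : 0 ≤ M)
    (hfn : ∀ k, fn (k + 4) (‖lam‖ ^ 2) ≤ M) {n : ℕ} (hn : 2 ≤ n) {F X : List Domino → ℂ}
    {c₀ c₁ : ℂ} (hF0 : ∀ D, cells D + 1 = n → F (monomer :: D) = lam ^ dimers D * c₀)
    (hF1 : ∀ D, cells D + 2 = n → F (dimer :: D) = lam ^ (dimers D + 1) * c₁)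
    (mean : (tilingWeight (‖lam‖ ^ 2) (n - 1) : ℂ) * c₀ +
      ((‖lam‖ ^ 2 : ℝ) : ℂ) * (tilingWeight (‖lam‖ ^ 2) (n - 2) : ℂ) * c₁ = 0)
    (hX1 : ∀ E, cells E + 2 = n → X (dimer :: E) = lam * X (monomer :: monomer :: E))
    (hX2 : ∀ E, cells E + 3 = n → X (monomer :: dimer :: E) =
      lam * X (monomer :: monomer :: monomer :: E)) :
    ‖∑ D ∈ tilings n, (starRingEnd ℂ) (X D) * F D‖ ^ 2 ≤
      M * (∑ D ∈ tilings n, ‖X D‖ ^ 2) * ∑ D ∈ tilings n, ‖F D‖ ^ 2 := by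
  have hr : 0 < ‖lam‖ ^ 2 := by positivity
  have hconj : (starRingEnd ℂ) lam * lam = ((‖lam‖ ^ 2 : ℝ) : ℂ) := by
    rw [Complex.conj_mul']; push_cast; rfl
  set r := ‖lam‖ ^ 2 with hrdef
  have rhs_nonneg : 0 ≤ M * (∑ D ∈ tilings n, ‖X D‖ ^ 2) * ∑ D ∈ tilings n, ‖F D‖ ^ 2 :=
    mul_nonneg (mul_nonneg hM (Finset.sum_nonneg fun _ _ => by positivity))
      (Finset.sum_nonneg fun _ _ => by positivity)
  obtain rfl | rfl | ⟨k, rfl⟩ : n = 2 ∨ n = 3 ∨ ∃ k, n = k + 4 := by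
    rcases n with _ | _ | _ | _ | k
    · omega
    · omega
    · simp
    · simp
    · exact Or.inr (Or.inr ⟨k, rfl⟩)
  -- For n = 2 and n = 3 the equations for `X` cover every tiling, so `X` is a multiple of the
  -- sector ground state and `mean` says that `F` is orthogonal to it.
  · convert rhs_nonneg using 1
    simp at mean
    rw [sum_tilings_succ_succ]
    simp only [tilings, Finset.sum_singleton]
    rw [hF0 _ rfl, hF1 _ rfl, hX1 _ rfl]
    simp only [dimers, map_mul]
    have : (starRingEnd ℂ) (X [monomer, monomer]) * (lam ^ 0 * c₀) +
      (starRingEnd ℂ) lam * (starRingEnd ℂ) (X [monomer, monomer]) * (lam ^ (0 + 1) * c₁) =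
      (starRingEnd ℂ) (X [monomer, monomer]) * (c₀ + ((starRingEnd ℂ) lam * lam) * c₁) := by ring
    rw [this, hconj]
    rw [mean]
    simp
  · convert rhs_nonneg using 1
    rw [show 3 - 1 = 0 + 2 by rfl, tilingWeight_succ_succ] at mean
    simp at mean
    rw [sum_tilings_succ_succ, sum_tilings_succ_succ]
    simp only [tilings, Finset.sum_singleton]
    rw [hF0 _ rfl, hF1 _ rfl, hF0 _ rfl, hX1 _ rfl, hX2 _ rfl]
    simp only [dimers, map_mul]
    set e := (starRingEnd ℂ) (X [monomer, monomer, monomer])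
    have : e * (lam ^ 0 * c₀) + (starRingEnd ℂ) lam * e * (lam ^ (0 + 1) * c₀) +
      (starRingEnd ℂ) lam * e * (lam ^ (0 + 1) * c₁) =
      e * ((1 + (starRingEnd ℂ) lam * lam) * c₀ + ((starRingEnd ℂ) lam * lam) * c₁) := by ring
    rw [this, hconj]
    rw [mean]
    simp
  -- Tilings are grouped by the orbits of the two rightmost exchanges: three share the amplitude of
  -- mmmE and two that of mmdE, up to powers of `lam`.
  · have hsum : ∀ {A : Type} [AddCommMonoid A] (f : List Domino → A),
        ∑ D ∈ tilings (k + 4), f D = ∑ E ∈ tilings (k + 1), (f (monomer :: monomer :: monomer :: E) +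
          f (monomer :: dimer :: E) + f (dimer :: monomer :: E)) +
          ∑ E ∈ tilings k, (f (monomer :: monomer :: dimer :: E) + f (dimer :: dimer :: E)) := by
      intro A _ f
      rw [sum_tilings_succ_succ, sum_tilings_succ_succ, sum_tilings_succ_succ,
        sum_tilings_succ_succ, Finset.sum_add_distrib, Finset.sum_add_distrib,
        Finset.sum_add_distrib]
      abel
    have z0 := tilingWeight_pos hr.le k
    have z1 := tilingWeight_pos hr.le (k + 1)
    have e2 := tilingWeight_succ_succ r k
    have e3 := tilingWeight_succ_succ r (k + 1)
    have z2 := tilingWeight_pos hr.le (k + 2)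
    have z3 := tilingWeight_pos hr.le (k + 3)
    have hM := fn_eq_of_alpha hr.le (alpha_succ hr.le) k ▸ hfn k
    -- The relation `mean` leaves one free parameter: c₀ = r Z_{k+2} t and c₁ = -Z_{k+3} t.
    obtain ⟨t, rfl⟩ : ∃ t, c₀ = r * tilingWeight r (k + 2) * t :=
      ⟨c₀ / (r * tilingWeight r (k + 2)), by
        rw [mul_div_cancel₀]
        exact_mod_cast (mul_pos hr z2).ne'⟩
    simp only [show k + 4 - 1 = k + 3 from rfl, show k + 4 - 2 = k + 2 from rfl] at mean
    have hc1 : c₁ = -(tilingWeight r (k + 3) * t) := by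
      have hne : (r : ℂ) * tilingWeight r (k + 2) ≠ 0 := by exact_mod_cast (mul_pos hr z2).ne'
      apply mul_left_cancel₀ hne
      linear_combination mean
    subst hc1
    set U := ∑ E ∈ tilings (k + 1), ‖X (monomer :: monomer :: monomer :: E)‖ ^ 2 with hU
    set W := ∑ E ∈ tilings k, ‖X (monomer :: monomer :: dimer :: E)‖ ^ 2 with hW
    have hU0 : 0 ≤ U := Finset.sum_nonneg fun _ _ => by positivity
    have hW0 : 0 ≤ W := Finset.sum_nonneg fun _ _ => by positivity
    have hX : ∑ D ∈ tilings (k + 4), ‖X D‖ ^ 2 = (1 + 2 * r) * U + (1 + r) * W := by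
      rw [hsum, hU, hW, Finset.mul_sum, Finset.mul_sum]
      congr 1
      · refine Finset.sum_congr rfl fun E hE => ?_
        rw [mem_tilings_iff_cells] at hE
        rw [hX1 (monomer :: E) (by simp [cells, hE]), hX2 E (by omega), norm_mul, mul_pow]
        ring
      · refine Finset.sum_congr rfl fun E hE => ?_
        rw [mem_tilings_iff_cells] at hE
        rw [hX1 (dimer :: E) (by simp [cells, hE]), norm_mul, mul_pow]
        ring
    have hF : ∑ D ∈ tilings (k + 4), ‖F D‖ ^ 2 =
        ‖t‖ ^ 2 * (r * tilingWeight r (k + 2) * tilingWeight r (k + 3) *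
          (r * tilingWeight r (k + 2) + tilingWeight r (k + 3))) := by
      have f0 : ∀ D ∈ tilings (k + 3), ‖F (monomer :: D)‖ ^ 2 =
          r ^ dimers D * (r * tilingWeight r (k + 2) * ‖t‖) ^ 2 := by
        intro D hD
        rw [mem_tilings_iff_cells] at hD
        rw [hF0 D (by omega), norm_mul, norm_mul, norm_mul, norm_pow, Complex.norm_real,
          Complex.norm_real, Real.norm_of_nonneg hr.le, Real.norm_of_nonneg z2.le, mul_pow,
          ← pow_mul, mul_comm (dimers D), pow_mul]
      have f1 : ∀ D ∈ tilings (k + 2), ‖F (dimer :: D)‖ ^ 2 =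
          r ^ dimers D * (r * (tilingWeight r (k + 3) * ‖t‖) ^ 2) := by
        intro D hD
        rw [mem_tilings_iff_cells] at hD
        rw [hF1 D (by omega), norm_mul, norm_neg, norm_mul, norm_pow, Complex.norm_real,
          Real.norm_of_nonneg z3.le, mul_pow, ← pow_mul, mul_comm (dimers D + 1), pow_mul]
        ring
      rw [sum_tilings_succ_succ, Finset.sum_congr rfl f0, Finset.sum_congr rfl f1,
        ← Finset.sum_mul, ← Finset.sum_mul]
      change tilingWeight r (k + 3) * _ + tilingWeight r (k + 2) * _ = _
      ring
    -- The recursion collapses the group sums: (1+r) r Z_{k+2} - r Z_{k+3} = r³ Z_k and r Z_{k+2} -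
    -- r Z_{k+3} = -r² Z_{k+1}.
    have hin : ∑ D ∈ tilings (k + 4), (starRingEnd ℂ) (X D) * F D =
        ((r ^ 3 * tilingWeight r k : ℝ) : ℂ) * t * ∑ E ∈ tilings (k + 1),
          (starRingEnd ℂ) (X (monomer :: monomer :: monomer :: E)) * lam ^ dimers E -
        ((r ^ 2 * tilingWeight r (k + 1) : ℝ) : ℂ) * t * ∑ E ∈ tilings k,
          (starRingEnd ℂ) (X (monomer :: monomer :: dimer :: E)) * lam ^ (dimers E + 1) := by
      rw [hsum, sub_eq_add_neg, ← neg_mul, Finset.mul_sum, Finset.mul_sum]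
      have e2' : (tilingWeight r (k + 2) : ℂ) = tilingWeight r (k + 1) + r * tilingWeight r k := by
        exact_mod_cast e2
      have e3' : (tilingWeight r (k + 3) : ℂ) =
          tilingWeight r (k + 2) + r * tilingWeight r (k + 1) := by exact_mod_cast e3
      congr 1
      · refine Finset.sum_congr rfl fun E hE => ?_
        rw [mem_tilings_iff_cells] at hE
        rw [hX1 (monomer :: E) (by simp [cells, hE]), hX2 E (by omega),
          hF0 _ (by simp [cells, hE]), hF0 _ (by simp [cells, hE]),
          hF1 _ (by simp [cells, hE])]
        simp only [dimers, map_mul]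
        generalize (starRingEnd ℂ) (X (monomer :: monomer :: monomer :: E)) = e
        push_cast
        rw [e3', e2']
        linear_combination (e * lam ^ dimers E * r * (tilingWeight r (k + 1) +
          r * tilingWeight r k) * t - e * lam ^ dimers E * (tilingWeight r (k + 1) +
          r * tilingWeight r k + r * tilingWeight r (k + 1)) * t) * hconj
      · refine Finset.sum_congr rfl fun E hE => ?_
        rw [mem_tilings_iff_cells] at hE
        rw [hX1 (dimer :: E) (by simp [cells, hE]),
          hF0 _ (by simp [cells, hE]), hF1 _ (by simp [cells, hE])]
        simp only [dimers, map_mul]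
        generalize (starRingEnd ℂ) (X (monomer :: monomer :: dimer :: E)) = e
        push_cast
        rw [e3', e2']
        linear_combination (-e * lam ^ (dimers E + 1) * (tilingWeight r (k + 1) +
          r * tilingWeight r k + r * tilingWeight r (k + 1)) * t) * hconj
    have cs : ∀ (m j : ℕ) (Y : List Domino → ℂ),
        ‖∑ E ∈ tilings m, (starRingEnd ℂ) (Y E) * lam ^ (dimers E + j)‖ ^ 2 ≤
          (∑ E ∈ tilings m, ‖Y E‖ ^ 2) * (r ^ j * tilingWeight r m) := by
      intro m j Y
      calc _ ≤ (∑ E ∈ tilings m, ‖Y E‖ * ‖lam‖ ^ (dimers E + j)) ^ 2 := by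
            gcongr
            refine (norm_sum_le _ _).trans_eq (Finset.sum_congr rfl fun E _ => ?_)
            rw [norm_mul, RCLike.norm_conj, norm_pow]
        _ ≤ _ := Finset.sum_mul_sq_le_sq_mul_sq _ _ _
        _ = _ := by
            rw [tilingWeight, Finset.mul_sum (f := fun D => r ^ dimers D)]
            congr 1
            refine Finset.sum_congr rfl fun E _ => ?_
            rw [← pow_mul, mul_comm, pow_mul, ← hrdef, pow_add, mul_comm]
    have cs1 := cs (k + 1) 0 fun E => X (monomer :: monomer :: monomer :: E)
    have cs2 := cs k 1 fun E => X (monomer :: monomer :: dimer :: E)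
    simp only [add_zero, pow_zero, one_mul, pow_one, ← hU, ← hW] at cs1 cs2
    rw [hin, hX, hF]
    generalize (∑ E ∈ tilings (k + 1),
      (starRingEnd ℂ) (X (monomer :: monomer :: monomer :: E)) * lam ^ dimers E) = p at *
    generalize (∑ E ∈ tilings k,
      (starRingEnd ℂ) (X (monomer :: monomer :: dimer :: E)) * lam ^ (dimers E + 1)) = q at *
    set y := tilingWeight r (k + 1)
    set z := tilingWeight r k
    have hp : (r ^ 3 * z * ‖t‖ * ‖p‖) ^ 2 ≤ ((r ^ 3 * z * ‖t‖) ^ 2 * y) * U := by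
      rw [mul_pow]
      nlinarith [mul_le_mul_of_nonneg_left cs1 (sq_nonneg (r ^ 3 * z * ‖t‖))]
    have hq : (r ^ 2 * y * ‖t‖ * ‖q‖) ^ 2 ≤ ((r ^ 2 * y * ‖t‖) ^ 2 * (r * z)) * W := by
      rw [mul_pow]
      nlinarith [mul_le_mul_of_nonneg_left cs2 (sq_nonneg (r ^ 2 * y * ‖t‖))]
    calc _ ≤ (r ^ 3 * z * ‖t‖ * ‖p‖ + r ^ 2 * y * ‖t‖ * ‖q‖) ^ 2 := by
          gcongr
          refine (norm_sub_le _ _).trans_eq ?_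
          rw [norm_mul, norm_mul, norm_mul, norm_mul, Complex.norm_real, Complex.norm_real,
            Real.norm_of_nonneg (by positivity), Real.norm_of_nonneg (by positivity)]
      _ ≤ ((r ^ 3 * z * ‖t‖) ^ 2 * y / (1 + 2 * r) + (r ^ 2 * y * ‖t‖) ^ 2 * (r * z) / (1 + r)) *
            ((1 + 2 * r) * U + (1 + r) * W) :=
          sq_add_le_of_sq_le (by positivity) (by positivity) hU0 hW0 hp hq (by positivity)
            (by positivity)
      _ = r ^ 4 * z * y / ((1 + r) * (1 + 2 * r) * tilingWeight r (k + 2) * tilingWeight r (k + 3)) *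
            ((1 + 2 * r) * U + (1 + r) * W) *
            (‖t‖ ^ 2 * (r * tilingWeight r (k + 2) * tilingWeight r (k + 3) *
          (r * tilingWeight r (k + 2) + tilingWeight r (k + 3)))) := by
          have e2'' : tilingWeight r (k + 2) = y + r * z := e2
          have e3'' : tilingWeight r (k + 3) = tilingWeight r (k + 2) + r * y := e3
          rw [mul_right_comm (r ^ 4 * z * y / _)]
          congr 1
          have : r * tilingWeight r (k + 2) + tilingWeight r (k + 3) =
              r * (1 + r) * z + (1 + 2 * r) * y := by rw [e3'', e2'']; ring
          rw [this]
          field_simp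
      _ ≤ _ := by gcongr


/-! ### Sectors and frames -/

/-- Each dimer of `D` is hopped into two monomers at the cost of one factor `lam`, while `P` stays
fixed. The rightmost block ever used ends two sites before the end of `D`, which explains the `- 2`
in the condition on `d`. -/
theorem Ground.lay_eq {lam : ℂ} {c d : ℤ} {f : (ℤ → Bool) → ℂ} (h : Ground lam c d f)
    (s : ℤ → Bool) {p : ℤ} : ∀ (D P : List Domino), c ≤ p - 3 * cells (P ++ D) + 1 →
    p - 3 * cells P - 2 ≤ d →
    f (lay s p (P ++ D)) = lam ^ dimers D * f (lay s p (P ++ List.replicate (cells D) monomer))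
  | [], P, _, _ => by simp [dimers, cells]
  | monomer :: D, P, hc, hd => by
    have e := h.lay_eq s D (P ++ [monomer]) (by simpa using hc)
      (by rw [cells_append]; push_cast; omega)
    simpa [dimers, cells, List.replicate_succ] using e
  | dimer :: D, P, hc, hd => by
    have e := h.lay_eq s D (P ++ [dimer]) (by simpa using hc)
      (by rw [cells_append]; push_cast; omega)
    rw [List.append_assoc, List.append_assoc, List.singleton_append, List.singleton_append] at e
    rw [cells_append, cells] at hc
    push_cast at hc
    rw [e, h.hop _ _ _ (by omega) (by omega)
      (hopPair_lay s (List.replicate (cells D) monomer) P p), dimers, cells, List.replicate_succ,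
      List.replicate_succ]
    ring

/-- At coupling 1 the indicator of the allowed set solves the equations, so `Ground.lay_eq` also
shows that retiling preserves allowedness. -/
theorem ground_allowed (a b : ℤ) [DecidablePred (Allowed a b)] :
    Ground 1 a b fun s => if Allowed a b s then 1 else 0 := by
  constructor
  · intro s x _ _ h0 h2
    rw [if_neg]
    intro h
    rw [h.gap2 x h0] at h2
    cases h2
  · intro s t x ha hb h
    simp only [h.allowed_iff ha hb, one_mul]

variable {a b p : ℤ}

theorem Allowed.lay {s : ℤ → Bool} (hs : Allowed a b s) (ha : a - 1 ≤ p) (hp : p ≤ b + 2)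
    {E : List Domino} (hE : cells E = cells (parse a s p)) : Allowed a b (lay s p E) := by
  classical
  have hc := cells_parse_le a s p ha
  have e1 := (ground_allowed a b).lay_eq s (p := p) (parse a s p) [] hc (by simp [cells]; omega)
  have e2 := (ground_allowed a b).lay_eq s (p := p) E [] (by rwa [List.nil_append, hE])
    (by simp [cells]; omega)
  rw [List.nil_append, List.nil_append, lay_parse, one_pow, one_mul] at e1
  rw [List.nil_append, List.nil_append, hE, one_pow, one_mul, ← e1, if_pos hs] at e2
  by_contra hcon
  rw [if_neg hcon] at e2
  exact zero_ne_one e2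

theorem parse_stop (a : ℤ) (s : ℤ → Bool) (p : ℤ) :
    parse a s (p - 3 * cells (parse a s p)) = [] := by
  induction p using parse_induction a s with
  | monomer p h1 h2 ih =>
    rw [parse_monomer h1 h2, cells]
    push_cast
    rwa [show p - 3 * ((cells (parse a s (p - 3)) : ℤ) + 1) =
      p - 3 - 3 * cells (parse a s (p - 3)) by ring]
  | dimer p h1 h2 ih =>
    rw [parse_dimer h1 h2, cells]
    push_cast
    rwa [show p - 3 * ((cells (parse a s (p - 6)) : ℤ) + 2) =
      p - 6 - 3 * cells (parse a s (p - 6)) by ring]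
  | done_reading p h1 h2 =>
    rw [parse_nil h1 h2, cells]
    simpa using parse_nil h1 h2

theorem parse_lay_of_cells (ha : a - 1 ≤ p) (s : ℤ → Bool) {E : List Domino}
    (hE : cells E = cells (parse a s p)) : parse a (lay s p E) p = E := by
  rw [parse_lay a s E p (by rw [hE]; exact cells_parse_le a s p ha), hE, parse_stop,
    List.append_nil]

/-- The representative of a sector: all dominoes read from `p` are replaced by monomers. -/
def root (a p : ℤ) (s : ℤ → Bool) : ℤ → Bool :=
  lay s p (List.replicate (cells (parse a s p)) monomer)

/-- The allowed configurations in which at least two cells are read from the site `p`. -/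
structure Active (a b p : ℤ) (s : ℤ → Bool) : Prop where
  allowed : Allowed a b s
  two_le : 2 ≤ cells (parse a s p)

theorem Active.lay {s : ℤ → Bool} (hs : Active a b p s) (ha : a - 1 ≤ p) (hp : p ≤ b + 2)
    {E : List Domino} (hE : cells E = cells (parse a s p)) : Active a b p (lay s p E) :=
  ⟨hs.allowed.lay ha hp hE, by rw [parse_lay_of_cells ha s hE, hE]; exact hs.two_le⟩

theorem root_lay (ha : a - 1 ≤ p) (s : ℤ → Bool) {E : List Domino}
    (hE : cells E = cells (parse a s p)) : root a p (lay s p E) = root a p s := by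
  rw [root, parse_lay_of_cells ha s hE, hE, lay_lay _ _ _ _ (by simpa using hE), root]

theorem lay_root (s : ℤ → Bool) {E : List Domino}
    (hE : cells E = cells (parse a s p)) : FQH.lay (root a p s) p E = FQH.lay s p E := by
  rw [root, lay_lay _ _ _ _ (by simp [hE])]

theorem parse_root (ha : a - 1 ≤ p) (s : ℤ → Bool) :
    parse a (root a p s) p = List.replicate (cells (parse a s p)) monomer :=
  parse_lay_of_cells ha s (by simp)

/-- As `x + 3 ≤ b ≤ p`, the only frames not covered by `HopPair.parse` are `x + 3` and `x + 4`;
these cut the block and read fewer than two cells. -/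
theorem HopPair.active {x : ℤ} {s t : ℤ → Bool} (h : HopPair x s t) (hx : a ≤ x)
    (hxb : x + 3 ≤ b) (hp : b ≤ p) (hs : Allowed a b s)
    (h2 : 2 ≤ cells (FQH.parse a s p) ∨ 2 ≤ cells (FQH.parse a t p)) :
    (x + 5 ≤ p - 3 * cells (FQH.parse a s p) ∧ FQH.parse a s p = FQH.parse a t p) ∨
    ∃ P Q, FQH.parse a s p = P ++ dimer :: Q ∧
      FQH.parse a t p = P ++ monomer :: monomer :: Q ∧ p = x + 5 + 3 * cells P := by
  by_cases h5 : x + 5 ≤ p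
  · exact h.parse (h.surround_left hs) (h.surround_right ((h.allowed_iff hx hxb).1 hs)) hx p h5
  · have := h.cells_parse_lt (a := a) (p := p) (by omega)
    omega

theorem HopPair.cells_eq {x : ℤ} {s t : ℤ → Bool} (h : HopPair x s t) (hx : a ≤ x)
    (hxb : x + 3 ≤ b) (hp : b ≤ p) (hs : Allowed a b s)
    (h2 : 2 ≤ cells (FQH.parse a s p) ∨ 2 ≤ cells (FQH.parse a t p)) :
    cells (FQH.parse a s p) = cells (FQH.parse a t p) := by
  rcases h.active hx hxb hp hs h2 with ⟨-, e⟩ | ⟨P, Q, e1, e2, -⟩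
  · rw [e]
  · rw [e1, e2, cells_append, cells_append]; rfl

theorem HopPair.active_iff {x : ℤ} {s t : ℤ → Bool} (h : HopPair x s t) (hx : a ≤ x)
    (hxb : x + 3 ≤ b) (hp : b ≤ p) : Active a b p s ↔ Active a b p t := by
  have i := h.allowed_iff hx hxb
  constructor
  · rintro ⟨h1, h2⟩
    exact ⟨i.1 h1, h.cells_eq hx hxb hp h1 (Or.inl h2) ▸ h2⟩
  · rintro ⟨h1, h2⟩
    exact ⟨i.2 h1, h.cells_eq hx hxb hp (i.2 h1) (Or.inr h2) ▸ h2⟩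

open Classical in
-- An active configuration is the same datum as its root together with a tiling of the cells read.
theorem sum_active {M : Type*} [AddCommMonoid M] (C : Finset (ℤ → Bool))
    (hC : ∀ s, s ∈ C ↔ ∀ y, s y = true → a ≤ y ∧ y ≤ b) (ha : a - 1 ≤ p) (hp : p ≤ b + 2)
    (f : (ℤ → Bool) → M) :
    ∑ s ∈ C with Active a b p s, f s =
      ∑ τ ∈ C with Active a b p τ ∧ root a p τ = τ,
        ∑ D ∈ tilings (cells (parse a τ p)), f (lay τ p D) := by
  rw [Finset.sum_sigma']
  refine Finset.sum_bij' (fun s _ => ⟨root a p s, parse a s p⟩) (fun x _ => lay x.1 p x.2)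
    ?_ ?_ ?_ ?_ ?_
  · intro s hs
    rw [Finset.mem_filter] at hs
    have h1 : Active a b p (root a p s) := hs.2.lay ha hp (by simp)
    rw [Finset.mem_sigma, Finset.mem_filter, hC, mem_tilings_iff_cells]
    exact ⟨⟨h1.allowed.supp, h1, root_lay ha s (by simp)⟩, by rw [parse_root ha]; simp⟩
  · rintro ⟨τ, D⟩ hx
    rw [Finset.mem_sigma, Finset.mem_filter, mem_tilings_iff_cells] at hx
    have h1 := hx.1.2.1.lay ha hp hx.2
    rw [Finset.mem_filter, hC]
    exact ⟨h1.allowed.supp, h1⟩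
  · intro s hs
    dsimp only
    rw [lay_root s rfl, lay_parse]
  · rintro ⟨τ, D⟩ hx
    rw [Finset.mem_sigma, Finset.mem_filter, mem_tilings_iff_cells] at hx
    dsimp only
    rw [root_lay ha τ hx.2, parse_lay_of_cells ha τ hx.2, hx.1.2.2]
  · intro s hs
    dsimp only
    rw [lay_root s rfl, lay_parse]

/-- With two cells read, the six sites ending at the frame show 100100, 011000 or 000100, and no two
of these fit together when shifted by one or two sites. -/
theorem eq_of_active_of_active {q : ℤ} {s : ℤ → Bool} (hp : b ≤ p ∧ p ≤ b + 2)
    (hq : b ≤ q ∧ q ≤ b + 2) (h1 : Active a b p s) (h2 : Active a b q s) : p = q := by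
  have key : ∀ p, 2 ≤ cells (parse a s p) → s p = false ∧ s (p - 1) = false ∧
      ((s (p - 5) = true ∧ s (p - 4) = false ∧ s (p - 3) = false ∧ s (p - 2) = true) ∨
      (s (p - 5) = false ∧ s (p - 4) = true ∧ s (p - 3) = true ∧ s (p - 2) = false) ∨
      (s (p - 5) = false ∧ s (p - 4) = false ∧ s (p - 3) = false ∧ s (p - 2) = true)) := by
    intro p hp
    by_cases i1 : a ≤ p - 2 ∧ MonomerAt s p
    · rw [parse_monomer i1.1 i1.2, cells] at hp
      by_cases i2 : a ≤ p - 3 - 2 ∧ MonomerAt s (p - 3)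
      · simp only [MonomerAt] at *; grind
      by_cases i3 : a ≤ p - 3 - 5 ∧ DimerAt s (p - 3)
      · simp only [MonomerAt, DimerAt] at *; grind
      rw [parse_nil i2 i3, cells] at hp
      omega
    by_cases i2 : a ≤ p - 5 ∧ DimerAt s p
    · simp only [MonomerAt, DimerAt] at *; grind
    rw [parse_nil i1 i2, cells] at hp
    omega
  have k1 := key p h1.two_le
  have k2 := key q h2.two_le
  clear key h1 h2
  by_contra hne
  obtain h | h | h | h : q = p + 1 ∨ q = p + 2 ∨ p = q + 1 ∨ p = q + 2 := by omega
  all_goals subst h; clear hp hq hne; grind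


/-! ### Consequences of orthogonality to the full kernel -/

theorem dimers_append (D E : List Domino) : dimers (D ++ E) = dimers D + dimers E := by
  induction D with
  | nil => simp [dimers]
  | cons T D ih => cases T <;> simp [dimers, ih]; ring

/-- The mean over a sector of `f` divided by the ground-state amplitudes, up to normalization,
for a function `f` that solves the equations of the left part. -/
noncomputable def sectorMean (lam : ℂ) (a p : ℤ) (f : (ℤ → Bool) → ℂ) (s : ℤ → Bool) : ℂ :=
  tilingWeight (‖lam‖ ^ 2) (cells (parse a s p) - 1) *
      f (lay s p (List.replicate (cells (parse a s p)) monomer)) +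
    ((‖lam‖ ^ 2 : ℝ) : ℂ) * tilingWeight (‖lam‖ ^ 2) (cells (parse a s p) - 2) *
      (lam⁻¹ * f (lay s p (dimer :: List.replicate (cells (parse a s p) - 2) monomer)))

variable {lam : ℂ} {f g : (ℤ → Bool) → ℂ}

open Classical in
-- A hop inside the tiling changes the number of dimers but not the mean; a hop beyond it avoids the
-- last three sites, so the mean inherits the equation from `f`. This builds a full ground state out
-- of `f`.
theorem ground_sectorMean (hp : b ≤ p ∧ p ≤ b + 2) (hf : Ground lam a (b - 3) f) :
    Ground lam a b fun s => if Active a b p s then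
      lam ^ dimers (parse a s p) * sectorMean lam a p f s else 0 := by
  constructor
  · intro s x _ _ h0 h2
    rw [if_neg]
    intro h
    rw [h.allowed.gap2 x h0] at h2
    cases h2
  · intro s t x hx hxb h
    by_cases hs : Active a b p s
    swap
    · rw [if_neg hs, if_neg (mt (h.active_iff hx hxb hp.1).2 hs), mul_zero]
    have ht := (h.active_iff hx hxb hp.1).1 hs
    have h2 := hs.two_le
    rw [if_pos hs, if_pos ht]
    rcases h.active hx hxb hp.1 hs.allowed (Or.inl h2) with ⟨i1, i2⟩ | ⟨P, Q, i1, i2, i3⟩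
    · have e : ∀ D, cells D = cells (parse a s p) → f (lay s p D) = lam * f (lay t p D) :=
        fun D hD => hf.hop _ _ x hx (by omega) (h.lay D p (by rw [hD]; omega))
      simp only [sectorMean]
      rw [e _ (cells_replicate _), e _ (by rw [cells, cells_replicate]; omega), i2]
      ring
    · have hn : cells (parse a s p) = cells (parse a t p) :=
        h.cells_eq hx hxb hp.1 hs.allowed (Or.inl h2)
      have hc : cells P + 2 ≤ cells (parse a s p) := by
        rw [i1, cells_append, cells]; omega
      have e : ∀ D, cells D = cells (parse a s p) → lay s p D = lay t p D := by
        intro D hD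
        funext y
        exact lay_congr D p y fun hy => h.off y (by omega)
      simp only [sectorMean]
      rw [← hn, e _ (cells_replicate _), e _ (by rw [cells, cells_replicate]; omega), i1, i2,
        dimers_append, dimers_append, dimers, dimers, dimers]
      ring

theorem conj_mul_self (lam : ℂ) : (starRingEnd ℂ) lam * lam = ((‖lam‖ ^ 2 : ℝ) : ℂ) := by
  rw [Complex.conj_mul']; push_cast; rfl

theorem conj_pow_mul_pow (lam : ℂ) (n : ℕ) :
    (starRingEnd ℂ) (lam ^ n) * lam ^ n = (((‖lam‖ ^ 2) ^ n : ℝ) : ℂ) := by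
  rw [map_pow, ← mul_pow, conj_mul_self, ← Complex.ofReal_pow]

/-- Once the rightmost domino is fixed, all further blocks end at p - 5 ≤ b - 3 at the latest, where
`f` satisfies the hopping equation. -/
theorem lay_monomer_cons (hp : p ≤ b + 2) (hf : Ground lam a (b - 3) f) {τ : ℤ → Bool}
    (ha : a - 1 ≤ p) {D : List Domino} (hD : cells D + 1 = cells (parse a τ p)) :
    f (lay τ p (monomer :: D)) =
      lam ^ dimers D * f (lay τ p (List.replicate (cells (parse a τ p)) monomer)) := by
  have hc := cells_parse_le a τ p ha
  have := hf.lay_eq τ (p := p) D [monomer] (by simp only [List.singleton_append, cells]; omega)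
    (by simp only [cells]; push_cast; omega)
  rw [← hD, List.replicate_succ]
  exact this

theorem lay_dimer_cons (hp : p ≤ b + 2) (hf : Ground lam a (b - 3) f) {τ : ℤ → Bool}
    (ha : a - 1 ≤ p) {D : List Domino} (hD : cells D + 2 = cells (parse a τ p)) :
    f (lay τ p (dimer :: D)) = lam ^ dimers D *
      f (lay τ p (dimer :: List.replicate (cells (parse a τ p) - 2) monomer)) := by
  have hc := cells_parse_le a τ p ha
  have := hf.lay_eq τ (p := p) D [dimer] (by simp only [List.singleton_append, cells]; omega)
    (by simp only [cells]; push_cast; omega)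
  rw [← hD, Nat.add_sub_cancel]
  exact this

theorem sum_lay_eq_sectorMean (hlam : lam ≠ 0) (hp : p ≤ b + 2) (ha : a - 1 ≤ p)
    (hf : Ground lam a (b - 3) f) {τ : ℤ → Bool} (h2 : 2 ≤ cells (parse a τ p)) :
    ∑ D ∈ tilings (cells (parse a τ p)), (starRingEnd ℂ) (lam ^ dimers D) * f (lay τ p D) =
      sectorMean lam a p f τ := by
  obtain ⟨m, hm⟩ := Nat.exists_eq_add_of_le' h2
  have h0 : ∀ D ∈ tilings (m + 1), (starRingEnd ℂ) (lam ^ dimers (monomer :: D)) *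
      f (lay τ p (monomer :: D)) = (((‖lam‖ ^ 2) ^ dimers D : ℝ) : ℂ) *
        f (lay τ p (List.replicate (cells (parse a τ p)) monomer)) := by
    intro D hD
    rw [mem_tilings_iff_cells] at hD
    rw [lay_monomer_cons hp hf ha (by omega), ← mul_assoc, dimers, conj_pow_mul_pow]
  have h1 : ∀ D ∈ tilings m, (starRingEnd ℂ) (lam ^ dimers (dimer :: D)) *
      f (lay τ p (dimer :: D)) = (((‖lam‖ ^ 2) ^ dimers D : ℝ) : ℂ) * ((starRingEnd ℂ) lam *
        f (lay τ p (dimer :: List.replicate (cells (parse a τ p) - 2) monomer))) := by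
    intro D hD
    rw [mem_tilings_iff_cells] at hD
    rw [lay_dimer_cons hp hf ha (by omega), dimers, pow_succ, map_mul, ← conj_pow_mul_pow]
    ring
  rw [sectorMean]
  generalize f (lay τ p (dimer :: List.replicate (cells (parse a τ p) - 2) monomer)) = c₁ at *
  generalize f (lay τ p (List.replicate (cells (parse a τ p)) monomer)) = c₀ at *
  rw [hm, sum_tilings_succ_succ, Finset.sum_congr rfl h0, Finset.sum_congr rfl h1,
    ← Finset.sum_mul, ← Finset.sum_mul, ← Complex.ofReal_sum, ← Complex.ofReal_sum,
    show m + 2 - 1 = m + 1 from rfl, Nat.add_sub_cancel, ← conj_mul_self]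
  change (tilingWeight (‖lam‖ ^ 2) (m + 1) : ℂ) * _ + (tilingWeight (‖lam‖ ^ 2) m : ℂ) * _ = _
  field_simp

variable {C : Finset (ℤ → Bool)} (hC : ∀ s, s ∈ C ↔ ∀ y, s y = true → a ≤ y ∧ y ≤ b)
  (horth : ∀ Ψ, Ground lam a b Ψ → ∑ s ∈ C, (starRingEnd ℂ) (Ψ s) * f s = 0)

include hC horth in
open Classical in
-- Testing `f` against the ground state of `ground_sectorMean` gives the sum over sectors of the
-- squared moduli of the means.
theorem sectorMean_eq_zero (hlam : lam ≠ 0) (hab : 10 ≤ b - a) (hp : b ≤ p ∧ p ≤ b + 2)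
    (hf : Ground lam a (b - 3) f) {τ : ℤ → Bool} (hτ : Active a b p τ) (hr : root a p τ = τ) :
    sectorMean lam a p f τ = 0 := by
  have ha : a - 1 ≤ p := by omega
  have h := horth _ (ground_sectorMean hp hf)
  have e : ∑ s ∈ C, (starRingEnd ℂ) (if Active a b p s then
      lam ^ dimers (parse a s p) * sectorMean lam a p f s else 0) * f s =
      ∑ s ∈ C with Active a b p s, (starRingEnd ℂ)
      (lam ^ dimers (parse a s p) * sectorMean lam a p f s) * f s := by
    rw [Finset.sum_filter]
    refine Finset.sum_congr rfl fun s _ => ?_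
    split_ifs <;> simp
  rw [e, sum_active C hC ha hp.2] at h
  have e2 : ∀ τ ∈ C.filter (fun τ => Active a b p τ ∧ root a p τ = τ),
      ∑ D ∈ tilings (cells (parse a τ p)), (starRingEnd ℂ) (lam ^ dimers (parse a (lay τ p D) p) *
        sectorMean lam a p f (lay τ p D)) * f (lay τ p D) =
      ((‖sectorMean lam a p f τ‖ ^ 2 : ℝ) : ℂ) := by
    intro τ hτ
    rw [Finset.mem_filter] at hτ
    rw [← conj_mul_self]
    -- One factor of the squared modulus is expanded as the sum over tilings; the conjugate factor
    -- is constant on the sector.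
    nth_rw 2 [← sum_lay_eq_sectorMean hlam hp.2 ha hf hτ.2.1.two_le]
    rw [Finset.mul_sum]
    refine Finset.sum_congr rfl fun D hD => ?_
    rw [mem_tilings_iff_cells] at hD
    have e3 : sectorMean lam a p f (lay τ p D) = sectorMean lam a p f τ := by
      simp only [sectorMean]
      rw [parse_lay_of_cells ha τ hD, hD, lay_lay _ _ _ _ (by simpa using hD),
        lay_lay _ _ _ _ (by rw [cells, cells_replicate]; have := hτ.2.1.two_le; omega)]
    rw [parse_lay_of_cells ha τ hD, e3, map_mul]
    ring
  rw [Finset.sum_congr rfl e2, ← Complex.ofReal_sum, Complex.ofReal_eq_zero,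
    Finset.sum_eq_zero_iff_of_nonneg fun _ _ => by positivity] at h
  have := h τ (Finset.mem_filter.2 ⟨(hC τ).2 hτ.allowed.supp, hτ, hr⟩)
  simpa using this

include hC horth in
open Classical in
-- Cut down to the inactive allowed configurations, `f` itself solves the equations on all of [a,
-- b]; testing `f` against this truncation gives a sum of |f|².
theorem eq_zero_of_inactive (hf : Ground lam a (b - 3) f)
    {s : ℤ → Bool} (hs : Allowed a b s) (hn : ∀ p, b ≤ p → p ≤ b + 2 → ¬ Active a b p s) :
    f s = 0 := by
  let U : (ℤ → Bool) → Prop := fun s => Allowed a b s ∧ ∀ p, b ≤ p → p ≤ b + 2 → ¬ Active a b p s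
  have hg : Ground lam a b fun s => if U s then f s else 0 := by
    constructor
    · intro s x _ _ h0 h2
      rw [if_neg]
      intro h
      rw [h.1.gap2 x h0] at h2
      cases h2
    · intro s t x hx hxb h
      have hU : U s ↔ U t := by
        simp only [U, h.allowed_iff hx hxb]
        refine and_congr_right fun _ => forall_congr' fun p => forall_congr' fun hp => ?_
        rw [h.active_iff hx hxb hp]
      by_cases hs : U s
      · rw [if_pos hs, if_pos (hU.1 hs)]
        apply hf.hop s t x hx _ h
        -- A hop touching the last three sites would make `x + 5` a frame in {b, b+1, b+2} at which
        -- a dimer, hence two cells, is read.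
        by_contra hxb'
        apply hs.2 (x + 5) (by omega) (by omega)
        refine ⟨hs.1, ?_⟩
        have hd : DimerAt s (x + 5) := by
          obtain ⟨s0, s1, s2, s3, -⟩ := id h
          have h1 := (h.surround_left hs.1).r1
          have h2 := (h.surround_left hs.1).r2
          simp only [DimerAt]
          grind
        rw [parse_dimer (by omega) hd, cells]
        omega
      · rw [if_neg hs, if_neg (mt hU.2 hs), mul_zero]
  have h := horth _ hg
  have e : ∀ s ∈ C, (starRingEnd ℂ) (if U s then f s else 0) * f s =
      (((if U s then ‖f s‖ ^ 2 else 0 : ℝ)) : ℂ) := by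
    intro s _
    split_ifs
    · rw [conj_mul_self]
    · simp
  rw [Finset.sum_congr rfl e, ← Complex.ofReal_sum, Complex.ofReal_eq_zero,
    Finset.sum_eq_zero_iff_of_nonneg fun _ _ => by positivity] at h
  have := h s ((hC s).2 hs.supp)
  rw [if_pos ⟨hs, hn⟩] at this
  simpa using this

/-! ### Summation over sectors and frames -/

theorem norm_sum_sq_le {ι : Type*} (S : Finset ι) {M : ℝ} (hM : 0 ≤ M) {I : ι → ℂ} {A B : ι → ℝ}
    (hA : ∀ i ∈ S, 0 ≤ A i) (hB : ∀ i ∈ S, 0 ≤ B i) (h : ∀ i ∈ S, ‖I i‖ ^ 2 ≤ M * A i * B i) :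
    ‖∑ i ∈ S, I i‖ ^ 2 ≤ M * (∑ i ∈ S, A i) * ∑ i ∈ S, B i := by
  rw [Finset.mul_sum (a := M)]
  refine le_trans ?_ (Finset.sum_sq_le_sum_mul_sum_of_sq_le_mul S
    (fun i hi => mul_nonneg hM (hA i hi)) hB h)
  gcongr
  exact norm_sum_le _ _

include hC horth in
open Classical in
theorem norm_sum_active_sq_le (hlam : lam ≠ 0) (hab : 10 ≤ b - a) {M : ℝ} (hM : 0 ≤ M)
    (hfn : ∀ k, fn (k + 4) (‖lam‖ ^ 2) ≤ M) (hp : b ≤ p ∧ p ≤ b + 2)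
    (hf : Ground lam a (b - 3) f) (hg : Ground lam (b - 8) b g) :
    ‖∑ s ∈ C with Active a b p s, (starRingEnd ℂ) (g s) * f s‖ ^ 2 ≤
      M * (∑ s ∈ C with Active a b p s, ‖g s‖ ^ 2) * ∑ s ∈ C with Active a b p s, ‖f s‖ ^ 2 := by
  have ha : a - 1 ≤ p := by omega
  rw [sum_active C hC ha hp.2, sum_active C hC ha hp.2, sum_active C hC ha hp.2]
  refine norm_sum_sq_le _ hM (fun _ _ => Finset.sum_nonneg fun _ _ => by positivity)
    (fun _ _ => Finset.sum_nonneg fun _ _ => by positivity) fun τ hτ => ?_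
  rw [Finset.mem_filter] at hτ
  have hm := sectorMean_eq_zero hC horth hlam hab hp hf hτ.2.1 hτ.2.2
  rw [sectorMean] at hm
  refine sector_bound hlam hM hfn hτ.2.1.two_le (F := fun D => f (lay τ p D))
    (X := fun D => g (lay τ p D)) (fun D hD => lay_monomer_cons hp.2 hf ha hD) (fun D hD => ?_) hm
    (fun E hE => ?_) (fun E hE => ?_)
  · rw [lay_dimer_cons hp.2 hf ha hD, pow_succ]
    field_simp
  · have := hopPair_lay τ E [] p
    rw [cells] at this
    exact hg.hop _ _ _ (by push_cast; omega) (by push_cast; omega) this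
  · have := hopPair_lay τ E [monomer] p
    rw [cells, cells] at this
    exact hg.hop _ _ _ (by push_cast; omega) (by push_cast; omega) this

include hC horth in
open Classical in
-- A configuration that contributes to the pairing is allowed, and then active in exactly one frame,
-- since `f` vanishes on the inactive ones.
theorem norm_sum_sq_le_of_ground (hlam : lam ≠ 0) (hab : 10 ≤ b - a) {M : ℝ} (hM : 0 ≤ M)
    (hfn : ∀ k, fn (k + 4) (‖lam‖ ^ 2) ≤ M)
    (hf : Ground lam a (b - 3) f) (hg : Ground lam (b - 8) b g) :
    ‖∑ s ∈ C, (starRingEnd ℂ) (g s) * f s‖ ^ 2 ≤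
      M * (∑ s ∈ C, ‖g s‖ ^ 2) * ∑ s ∈ C, ‖f s‖ ^ 2 := by
  have split : ∀ {A : Type} [AddCommMonoid A] (u : (ℤ → Bool) → A) (s : ℤ → Bool),
      (∑ p ∈ Finset.Icc b (b + 2), if Active a b p s then u s else 0) =
        if ∃ p, b ≤ p ∧ p ≤ b + 2 ∧ Active a b p s then u s else 0 := by
    intro A _ u s
    split_ifs with h
    · obtain ⟨p, h1, h2, h3⟩ := h
      rw [Finset.sum_eq_single_of_mem p (Finset.mem_Icc.2 ⟨h1, h2⟩), if_pos h3]
      intro q hq hne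
      rw [Finset.mem_Icc] at hq
      rw [if_neg]
      exact fun h => hne (eq_of_active_of_active hq ⟨h1, h2⟩ h h3)
    · refine Finset.sum_eq_zero fun p hp => ?_
      rw [Finset.mem_Icc] at hp
      rw [if_neg fun h3 => h ⟨p, hp.1, hp.2, h3⟩]
  have norm_le : ∀ u : (ℤ → Bool) → ℂ, ∑ p ∈ Finset.Icc b (b + 2),
      ∑ s ∈ C with Active a b p s, ‖u s‖ ^ 2 ≤ ∑ s ∈ C, ‖u s‖ ^ 2 := by
    intro u
    simp only [Finset.sum_filter]
    rw [Finset.sum_comm]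
    refine Finset.sum_le_sum fun s _ => ?_
    rw [split fun s => ‖u s‖ ^ 2]
    split_ifs
    · exact le_rfl
    · positivity
  have hin : ∑ s ∈ C, (starRingEnd ℂ) (g s) * f s = ∑ p ∈ Finset.Icc b (b + 2),
      ∑ s ∈ C with Active a b p s, (starRingEnd ℂ) (g s) * f s := by
    simp only [Finset.sum_filter]
    rw [Finset.sum_comm]
    refine Finset.sum_congr rfl fun s hs => ?_
    rw [split fun s => (starRingEnd ℂ) (g s) * f s]
    split_ifs with h
    · rfl
    · by_cases h1 : f s = 0
      · rw [h1, mul_zero]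
      by_cases h2 : g s = 0
      · rw [h2, map_zero, zero_mul]
      exfalso
      push Not at h
      exact h1 (eq_zero_of_inactive hC horth hf
        (hf.allowed hlam hab hg ((hC s).1 hs) h1 h2) h)
  rw [hin]
  refine (norm_sum_sq_le _ hM (fun _ _ => Finset.sum_nonneg fun _ _ => by positivity)
    (fun _ _ => Finset.sum_nonneg fun _ _ => by positivity) fun p hp =>
      norm_sum_active_sq_le hC horth hlam hab hM hfn (Finset.mem_Icc.1 hp) hf hg).trans ?_
  exact mul_le_mul (mul_le_mul_of_nonneg_left (norm_le g) hM) (norm_le f)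
    (Finset.sum_nonneg fun _ _ => Finset.sum_nonneg fun _ _ => by positivity)
    (mul_nonneg hM (Finset.sum_nonneg fun _ _ => by positivity))


/-! ### The supremum and the return to operators -/

theorem fn_nonneg {r : ℝ} (hr : 0 ≤ r) (n : ℕ) : 0 ≤ fn (n + 4) r := by
  rw [fn_eq_of_alpha hr (alpha_succ hr)]
  have h0 := tilingWeight_pos hr n
  have h1 := tilingWeight_pos hr (n + 1)
  have h2 := tilingWeight_pos hr (n + 2)
  have h3 := tilingWeight_pos hr (n + 3)
  positivity

theorem bddAbove_fn {r : ℝ} (hr : 0 ≤ r) :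
    BddAbove (Set.range fun n : {n : ℕ // 4 ≤ n} => fn n r) := by
  refine ⟨r * (√(1 + r) - 1) ^ 2 / ((1 + r) * (1 + 2 * r)), ?_⟩
  rintro _ ⟨⟨n, hn⟩, rfl⟩
  obtain ⟨k, rfl⟩ := Nat.exists_eq_add_of_le' hn
  exact fn_le hr (alpha_succ hr) k

theorem fn_le_fsup {r : ℝ} (hr : 0 ≤ r) (k : ℕ) : fn (k + 4) r ≤ fsup r :=
  le_ciSup (bddAbove_fn hr) (⟨k + 4, by omega⟩ : {n : ℕ // 4 ≤ n})

theorem fsup_le {r : ℝ} (hr : 0 ≤ r) :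
    fsup r ≤ r * (√(1 + r) - 1) ^ 2 / ((1 + r) * (1 + 2 * r)) := by
  have : Nonempty {n : ℕ // 4 ≤ n} := ⟨⟨4, le_rfl⟩⟩
  refine ciSup_le ?_
  rintro ⟨n, hn⟩
  obtain ⟨k, rfl⟩ := Nat.exists_eq_add_of_le' hn
  exact fn_le hr (alpha_succ hr) k

theorem mem_image_ext {Λ : Finset ℤ} [DecidableEq (ℤ → Bool)] (s : ℤ → Bool) :
    s ∈ Finset.univ.image (ext Λ) ↔ ∀ y, s y = true → y ∈ Λ := by
  rw [Finset.mem_image]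
  constructor
  · rintro ⟨σ, -, rfl⟩ y h
    by_contra hc
    simp [ext, hc] at h
  · intro h
    exact ⟨res Λ s, Finset.mem_univ _, ext_res Λ s h⟩

theorem sum_image_ext {Λ : Finset ℤ} [DecidableEq (ℤ → Bool)] {A : Type*} [AddCommMonoid A]
    (u : Config Λ → A) : ∑ s ∈ Finset.univ.image (ext Λ), u (res Λ s) = ∑ σ, u σ := by
  rw [Finset.sum_image fun σ _ τ _ h => by rw [← res_ext Λ σ, h, res_ext]]
  simp only [res_ext]

theorem norm_gsProj_mul_sq_le {lam : ℂ} (hlam : lam ≠ 0) {κ : ℝ} (hκ : 0 < κ) {a b : ℤ}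
    (hab : 10 ≤ b - a) {M : ℝ} (hM : 0 ≤ M) (hfn : ∀ k, fn (k + 4) (‖lam‖ ^ 2) ≤ M) :
    ‖gsProj (Finset.Icc a b) κ lam (b - 8) b * (1 - gsProj (Finset.Icc a b) κ lam a b) *
      gsProj (Finset.Icc a b) κ lam a (b - 3)‖ ^ 2 ≤ M := by
  classical
  have i1 : Finset.Icc a (b - 3) ⊆ Finset.Icc a b := Finset.Icc_subset_Icc le_rfl (by omega)
  have i2 : Finset.Icc (b - 8) b ⊆ Finset.Icc a b := Finset.Icc_subset_Icc (by omega) le_rfl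
  refine norm_proj_mul_sq_le _ _ _ ?_ hM ?_
  · intro v hv
    rw [LinearMap.mem_ker] at hv ⊢
    have h := (ham_eq_zero_iff hκ lam (Finset.Subset.refl _) v).1 hv
    refine (ham_eq_zero_iff hκ lam i1 v).2 ⟨fun x hx => h.1 x ?_, fun x hx => h.2 x ?_⟩
    · rw [Finset.mem_Icc] at hx ⊢; omega
    · rw [Finset.mem_Icc] at hx ⊢; omega
  · intro f hf hforth g hg
    have hf' : Ground lam a (b - 3) fun s => f (res _ s) := ground_of_ham_eq_zero hκ i1 hf
    have hg' : Ground lam (b - 8) b fun s => g (res _ s) := ground_of_ham_eq_zero hκ i2 hg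
    have hC : ∀ s : ℤ → Bool, s ∈ Finset.univ.image (ext (Finset.Icc a b)) ↔
        ∀ y, s y = true → a ≤ y ∧ y ≤ b := by
      intro s
      simp only [mem_image_ext, Finset.mem_Icc]
    have inner_eq : ∀ u v : Hilb (Finset.Icc a b), inner ℂ u v =
        ∑ s ∈ Finset.univ.image (ext (Finset.Icc a b)),
          (starRingEnd ℂ) (u (res _ s)) * v (res _ s) := by
      intro u v
      rw [sum_image_ext fun σ => (starRingEnd ℂ) (u σ) * v σ, PiLp.inner_apply]
      exact Finset.sum_congr rfl fun σ _ => by rw [RCLike.inner_apply, mul_comm]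
    have norm_eq : ∀ u : Hilb (Finset.Icc a b), ‖u‖ ^ 2 =
        ∑ s ∈ Finset.univ.image (ext (Finset.Icc a b)), ‖u (res _ s)‖ ^ 2 := by
      intro u
      rw [sum_image_ext fun σ => ‖u σ‖ ^ 2, EuclideanSpace.norm_sq_eq]
    rw [inner_eq, norm_eq g, norm_eq f]
    refine norm_sum_sq_le_of_ground hC ?_ hlam hab hM hfn hf' hg'
    intro Ψ hΨ
    -- Orthogonality to the kernel becomes orthogonality to every solution `Ψ` of the equations once
    -- `Ψ` is restricted to configurations on [a, b].
    let v : Hilb (Finset.Icc a b) := WithLp.toLp 2 fun σ => Ψ (ext _ σ)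
    have hv : ∀ s : ℤ → Bool, (∀ y, s y = true → y ∈ Finset.Icc a b) → v (res _ s) = Ψ s := by
      intro s hs
      change Ψ (ext _ (res _ s)) = Ψ s
      rw [ext_res _ s hs]
    have hker : ham (Finset.Icc a b) κ lam a b v = 0 :=
      ham_eq_zero_of_ground hκ (Finset.Subset.refl _) hΨ hv
    have h0 : inner ℂ v f = 0 := hforth v hker
    rw [inner_eq] at h0
    rw [← h0]
    refine Finset.sum_congr rfl fun s hs => ?_
    rw [hv s ((mem_image_ext s).1 hs)]

end FQH

theorem lemma3 (lam : ℂ) :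
    (∀ k : ℕ, 1 ≤ k →
      ‖FQH.phi lam (k - 1)‖ ^ 2 / ‖FQH.phi lam k‖ ^ 2 = FQH.alpha (‖lam‖ ^ 2) k) ∧
    BddAbove (Set.range fun n : {n : ℕ // 4 ≤ n} => FQH.fn n (‖lam‖ ^ 2)) ∧
    (lam ≠ 0 → ∀ κ : ℝ, 0 < κ → ∀ a b : ℤ, 11 ≤ b - a + 1 →
      ‖FQH.gsProj (Finset.Icc a b) κ lam (b - 8) b *
          (1 - FQH.gsProj (Finset.Icc a b) κ lam a b) *
          FQH.gsProj (Finset.Icc a b) κ lam a (b - 3)‖ ^ 2 ≤ FQH.fsup (‖lam‖ ^ 2)) ∧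
    (‖lam‖ < 5.3 → FQH.fsup (‖lam‖ ^ 2) < 1 / 3) := by
  have hr : 0 ≤ ‖lam‖ ^ 2 := by positivity
  refine ⟨fun k hk => ?_, FQH.bddAbove_fn hr, fun hlam κ hκ a b hab => ?_, fun h => ?_⟩
  · obtain ⟨j, rfl⟩ := Nat.exists_eq_add_of_le' hk
    rw [FQH.alpha_succ hr, FQH.norm_phi_sq, FQH.norm_phi_sq, Nat.add_sub_cancel]
  · exact FQH.norm_gsProj_mul_sq_le hlam hκ (by omega)
      ((FQH.fn_nonneg hr 0).trans (FQH.fn_le_fsup hr 0)) (FQH.fn_le_fsup hr)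
  · exact (FQH.fsup_le hr).trans_lt (FQH.sqrt_bound_lt hr (by gcongr))
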